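/- **Proposition (braid identity for infusion).** Let $\Lambda$ be a rectangular shape (with $m\ge 0$ rows and $n\ge 0$ columns). A standard Young tableau $T$ of skew shape $\nu/\mu$ is a filling of the boxes of $\nu/\mu$ by $1,\dots,|\nu/\mu|$, each used once, increasing along rows and down columns. It is identified with its *shape chain*, the chain of Young diagrams from $\mu$ to $\nu$ whose $i$-th member consists of $\mu$ and the boxes of $T$ with label at most $i$. Let $U$ and $T$ be standard tableaux of shapes $\mu/\lambda$ and $\nu/\mu$. Their *growth diagram* is the rectangular array of Young diagrams whose left column, read upwards, is the shape chain of $U$, whose top row, read from left to right, is the shape chain of $T$, and in which every elementary square $\begin{matrix}\alpha&-&\beta\\ |&&|\\ \gamma&-&\delta\end{matrix}$ obeys Fomin's local rule: if $\alpha$ is the only shape strictly between $\gamma$ and $\beta$, then $\delta=\alpha$; otherwise there is exactly one other such shape, and it is $\delta$. Let $\mathtt{infusion}_1(U,T)$ be the tableau whose shape chain is the bottom row read from left to right, and $\mathtt{infusion}_2(U,T)$ the tableau whose shape chain is the right column read upwards. A *layered tableau* $A\star B\star C$ of shape $\Lambda$ consists of Young diagrams $\alpha\subseteq\gamma\subseteq\Lambda$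 and standard tableaux $A$, $B$, $C$ of shapes $\alpha$, $\gamma/\alpha$, $\Lambda/\gamma$ respectively. Define operators on the set of layered tableaux of shape $\Lambda$ by $$\mathcal I_1(A\star B\star C)=\mathtt{infusion}_1(A,B)\star\mathtt{infusion}_2(A,B)\star C,\qquad \mathcal I_2(A\star B\star C)=A\star\mathtt{infusion}_1(B,C)\star\mathtt{infusion}_2(B,C).$$ Then $$\mathcal I_1\circ\mathcal I_2\circ\mathcal I_1=\mathcal I_2\circ\mathcal I_1\circ\mathcal I_2 .$$ Moreover $\mathcal I_1^2=\mathcal I_2^2=\mathrm{id}$, so there is an action of the symmetric group $S_3$ on the set of layered tableaux of shape $\Lambda$ in which the two adjacent transpositions act as $\mathcal I_1$ and $\mathcal I_2$. -/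

import Mathlib

namespace LayeredTableaux

/-- `OneBox μ ν`: the shape `ν` is obtained from the shape `μ` by adding exactly one box. -/
def OneBox (μ ν : YoungDiagram) : Prop :=
  μ ≤ ν ∧ ν.card = μ.card + 1

/-- The rectangular shape with `m` rows and `n` columns. -/
def rectangle (m n : ℕ) : YoungDiagram where
  cells := Finset.range m ×ˢ Finset.range n
  isLowerSet := by
    rintro ⟨a, b⟩ ⟨c, d⟩ ⟨h1, h2⟩ h
    simp only [Finset.coe_product, Set.mem_prod, Finset.mem_coe, Finset.mem_range] at h h1 h2 ⊢
    exact ⟨lt_of_le_of_lt h1 h.1, lt_of_le_of_lt h2 h.2⟩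

/-- A standard Young tableau of skew shape `nu / lam`: a filling of the boxes of `nu / lam` by
`1, 2, …, |nu / lam|`, each used once, that increases to the right along rows and down columns
(equivalently, along the "weakly northwest" order on boxes, which is the product order on `ℕ × ℕ`).
Outside `nu / lam` the filling takes the value `0`, so that equal tableaux are equal terms.
A tableau of straight shape `nu` is a `SYT ⊥ nu`. -/
@[ext]
structure SYT (lam nu : YoungDiagram) where
  entry : ℕ × ℕ → ℕ
  le : lam ≤ nu
  bijOn : Set.BijOn entry (nu.cells \ lam.cells : Finset (ℕ × ℕ))
    (Set.Icc 1 (nu.cells \ lam.cells).card)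
  increasing : ∀ x ∈ nu.cells \ lam.cells, ∀ y ∈ nu.cells \ lam.cells, x < y → entry x < entry y
  outside : ∀ x, x ∉ nu.cells \ lam.cells → entry x = 0

namespace SYT

variable {lam nu : YoungDiagram}

/-- The number of boxes of the tableau. -/
def size (_T : SYT lam nu) : ℕ := (nu.cells \ lam.cells).card

/-- The shape chain of a tableau: `T.chain i` consists of the inner shape `lam` together with
the boxes of `nu / lam` whose label is at most `i`. -/
def chain (T : SYT lam nu) (i : ℕ) : YoungDiagram where
  cells := lam.cells ∪ (nu.cells \ lam.cells).filter (fun x => T.entry x ≤ i)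
  isLowerSet := by
    intro x y hyx hx
    simp only [Finset.coe_union, Finset.coe_filter, Set.mem_union, Finset.mem_coe,
      Set.mem_ofPred_eq] at hx ⊢
    by_cases hy : y ∈ lam.cells
    · exact Or.inl hy
    · rcases hx with hx | ⟨hx, hxi⟩
      · exact absurd (lam.isLowerSet hyx hx) hy
      · have hy' : y ∈ nu.cells \ lam.cells :=
          Finset.mem_sdiff.2 ⟨nu.isLowerSet hyx (Finset.mem_sdiff.1 hx).1, hy⟩
        refine Or.inr ⟨hy', ?_⟩
        rcases eq_or_lt_of_le hyx with h | h
        · rw [h]; exact hxi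
        · exact (T.increasing y hy' x hx h).le.trans hxi

theorem chain_zero (T : SYT lam nu) : T.chain 0 = lam := by
  ext x
  simp only [chain, Finset.mem_union, Finset.mem_filter]
  constructor
  · rintro (h | ⟨h, h0⟩)
    · exact h
    · have := (T.bijOn.mapsTo (Finset.mem_coe.2 h)).1
      omega
  · exact Or.inl

theorem chain_size (T : SYT lam nu) : T.chain T.size = nu := by
  ext x
  simp only [chain, Finset.mem_union, Finset.mem_filter]
  constructor
  · rintro (h | ⟨h, h0⟩)
    · exact T.le h
    · exact (Finset.mem_sdiff.1 h).1
  · intro h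
    by_cases hx : x ∈ lam.cells
    · exact Or.inl hx
    · have h' : x ∈ nu.cells \ lam.cells := Finset.mem_sdiff.2 ⟨h, hx⟩
      exact Or.inr ⟨h', (T.bijOn.mapsTo (Finset.mem_coe.2 h')).2⟩

theorem chain_oneBox (T : SYT lam nu) {i : ℕ} (hi : i < T.size) :
    OneBox (T.chain i) (T.chain (i + 1)) := by
  obtain ⟨x, hx, hxi⟩ := T.bijOn.surjOn (show i + 1 ∈ Set.Icc 1 (nu.cells \ lam.cells).card from
    ⟨by omega, hi⟩)
  have hx' : x ∈ nu.cells \ lam.cells := Finset.mem_coe.1 hx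
  have hnot : x ∉ (T.chain i).cells := by
    simp only [chain, Finset.mem_union, Finset.mem_filter, not_or, not_and]
    exact ⟨(Finset.mem_sdiff.1 hx').2, fun _ => by omega⟩
  have hcells : (T.chain (i + 1)).cells = insert x (T.chain i).cells := by
    ext y
    simp only [chain, Finset.mem_union, Finset.mem_filter, Finset.mem_insert]
    constructor
    · rintro (h | ⟨h, hle⟩)
      · exact Or.inr (Or.inl h)
      · rcases Nat.lt_or_ge i (T.entry y) with h' | h'
        · exact Or.inl (T.bijOn.injOn (Finset.mem_coe.2 h) hx (by omega))
        · exact Or.inr (Or.inr ⟨h, h'⟩)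
    · rintro (rfl | h | ⟨h, hle⟩)
      · exact Or.inr ⟨hx', by omega⟩
      · exact Or.inl h
      · exact Or.inr ⟨h, by omega⟩
  refine ⟨?_, ?_⟩
  · rw [← YoungDiagram.cells_subset_iff, hcells]
    exact Finset.subset_insert _ _
  · simp only [YoungDiagram.card]
    rw [hcells, Finset.card_insert_of_notMem hnot]

end SYT

section OfChain

variable {c : ℕ → YoungDiagram} {k : ℕ}

theorem chain_le (hc : ∀ i < k, OneBox (c i) (c (i + 1))) {i j : ℕ} (hij : i ≤ j) (hj : j ≤ k) :
    c i ≤ c j := by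
  induction j, hij using Nat.le_induction with
  | base => exact le_rfl
  | succ j hij ih => exact (ih (by omega)).trans (hc j (by omega)).1

theorem chain_card (hc : ∀ i < k, OneBox (c i) (c (i + 1))) {i : ℕ} (hi : i ≤ k) :
    (c i).card = (c 0).card + i := by
  induction i with
  | zero => rfl
  | succ i ih => rw [(hc i (by omega)).2, ih (by omega)]; rfl

open Classical in
/-- The filling encoded by a shape chain `c 0 ⊂ c 1 ⊂ ⋯ ⊂ c k`: the box added in passing from
`c (i - 1)` to `c i` receives the label `i`. -/
noncomputable def chainEntry (c : ℕ → YoungDiagram) (k : ℕ) (x : ℕ × ℕ) : ℕ :=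
  if h : x ∈ (c k).cells \ (c 0).cells then
    Nat.find (p := fun i => x ∈ (c i).cells) ⟨k, (Finset.mem_sdiff.1 h).1⟩
  else 0

theorem chainEntry_le_iff (hc : ∀ i < k, OneBox (c i) (c (i + 1))) {x : ℕ × ℕ}
    (hx : x ∈ (c k).cells \ (c 0).cells) {i : ℕ} (hi : i ≤ k) :
    chainEntry c k x ≤ i ↔ x ∈ (c i).cells := by
  classical
  rw [chainEntry, dif_pos hx]
  constructor
  · intro h
    have h1 := Nat.find_spec (p := fun i => x ∈ (c i).cells) ⟨k, (Finset.mem_sdiff.1 hx).1⟩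
    exact (chain_le hc h hi) h1
  · intro h
    exact Nat.find_min' _ h

/-- The standard tableau encoded by a shape chain from `lam` to `nu`. -/
noncomputable def SYT.ofChain {lam nu : YoungDiagram} (c : ℕ → YoungDiagram) (k : ℕ)
    (hc : ∀ i < k, OneBox (c i) (c (i + 1))) (h0 : c 0 = lam) (hk : c k = nu) :
    SYT lam nu where
  entry := chainEntry c k
  le := by
    rw [← h0, ← hk]
    exact chain_le hc (Nat.zero_le _) le_rfl
  bijOn := by
    classical
    subst h0 hk
    have hsub : (c 0).cells ⊆ (c k).cells := chain_le hc (Nat.zero_le _) le_rfl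
    have hcard : ((c k).cells \ (c 0).cells).card = k := by
      have h := chain_card hc (le_refl k)
      simp only [YoungDiagram.card] at h
      rw [Finset.card_sdiff_of_subset hsub]
      omega
    rw [hcard]
    have hmaps : ∀ x ∈ (c k).cells \ (c 0).cells, 1 ≤ chainEntry c k x ∧ chainEntry c k x ≤ k := by
      intro x hx
      refine ⟨?_, (chainEntry_le_iff hc hx le_rfl).2 (Finset.mem_sdiff.1 hx).1⟩
      by_contra h
      exact (Finset.mem_sdiff.1 hx).2 ((chainEntry_le_iff hc hx (Nat.zero_le k)).1 (by omega))
    have hsurj : Set.SurjOn (chainEntry c k) ((c k).cells \ (c 0).cells : Finset (ℕ × ℕ))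
        (Set.Icc 1 k) := by
      rintro i ⟨hi1, hik⟩
      have hi : i - 1 + 1 = i := by omega
      have hbox := hc (i - 1) (by omega)
      rw [hi] at hbox
      have hlt : (c (i - 1)).cells.card < (c i).cells.card := by
        have := hbox.2
        simp only [YoungDiagram.card] at this
        omega
      obtain ⟨x, hx, hx'⟩ := Finset.exists_mem_notMem_of_card_lt_card hlt
      have hxk : x ∈ (c k).cells \ (c 0).cells :=
        Finset.mem_sdiff.2 ⟨chain_le hc hik le_rfl hx,
          fun h => hx' (chain_le hc (Nat.zero_le (i - 1)) (by omega) h)⟩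
      refine ⟨x, Finset.mem_coe.2 hxk, ?_⟩
      have h1 := (chainEntry_le_iff hc hxk hik).2 hx
      have h2 : ¬ chainEntry c k x ≤ i - 1 := fun h =>
        hx' ((chainEntry_le_iff hc hxk (by omega)).1 h)
      omega
    refine ⟨fun x hx => hmaps x (Finset.mem_coe.1 hx), ?_, hsurj⟩
    have hsurj' : Set.SurjOn (chainEntry c k) ((c k).cells \ (c 0).cells : Finset (ℕ × ℕ))
        (Finset.Icc 1 k : Finset ℕ) := by
      rwa [Finset.coe_Icc]
    refine Finset.injOn_of_surjOn_of_card_le _ (t := Finset.Icc 1 k) ?_ hsurj' ?_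
    · intro x hx
      rw [Finset.mem_coe, Finset.mem_Icc]
      exact hmaps x (Finset.mem_coe.1 hx)
    · rw [hcard, Nat.card_Icc]
      omega
  increasing := by
    subst h0 hk
    intro x hx y hy hxy
    have hyk := (chainEntry_le_iff hc hy le_rfl).2 (Finset.mem_sdiff.1 hy).1
    have hymem := (chainEntry_le_iff hc hy hyk).1 le_rfl
    have hle := (chainEntry_le_iff hc hx hyk).2 ((c _).isLowerSet hxy.le hymem)
    refine lt_of_le_of_ne hle ?_
    intro heq
    have hpos : 1 ≤ chainEntry c k y := by
      by_contra h
      exact (Finset.mem_sdiff.1 hy).2 ((chainEntry_le_iff hc hy (Nat.zero_le k)).1 (by omega))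
    obtain ⟨e, he⟩ : ∃ e, chainEntry c k y = e + 1 := ⟨chainEntry c k y - 1, by omega⟩
    have hbox := hc e (by omega)
    have hxe : x ∉ (c e).cells := fun h => by
      have := (chainEntry_le_iff hc hx (by omega)).2 h
      omega
    have hye : y ∉ (c e).cells := fun h => by
      have := (chainEntry_le_iff hc hy (by omega)).2 h
      omega
    have hx1 : x ∈ (c (e + 1)).cells := (chainEntry_le_iff hc hx (by omega)).1 (by omega)
    have hy1 : y ∈ (c (e + 1)).cells := (chainEntry_le_iff hc hy (by omega)).1 (by omega)
    have hsub : insert x (insert y (c e).cells) ⊆ (c (e + 1)).cells := by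
      intro z hz
      rcases Finset.mem_insert.1 hz with rfl | hz
      · exact hx1
      · rcases Finset.mem_insert.1 hz with rfl | hz
        · exact hy1
        · exact hbox.1 hz
    have hc1 := Finset.card_le_card hsub
    have hc2 := hbox.2
    simp only [YoungDiagram.card] at hc2
    rw [Finset.card_insert_of_notMem, Finset.card_insert_of_notMem hye] at hc1
    · omega
    · rw [Finset.mem_insert]
      rintro (h | h)
      · exact hxy.ne h
      · exact hxe h
  outside := by
    subst h0 hk
    intro x hx
    rw [chainEntry, dif_neg hx]

end OfChain

open Classical in
/-- The Fomin local rule. In a square of a growth diagram with corners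
`α - β` (top) and `γ - δ` (bottom), where `γ` is the smallest and `β` the largest shape, the shape
`δ = corner γ α β` is determined as follows: if `α` is the only shape strictly between `γ` and `β`,
then `δ = α`; otherwise `δ` is the shape other than `α` that lies strictly between `γ` and `β`
(there is only one, since `β` has two boxes more than `γ`). -/
noncomputable def corner (γ α β : YoungDiagram) : YoungDiagram :=
  if h : ∃ δ : YoungDiagram, γ < δ ∧ δ < β ∧ δ ≠ α then h.choose else α

theorem corner_oneBox {γ α β : YoungDiagram} (h1 : OneBox γ α) (h2 : OneBox α β) :
    OneBox γ (corner γ α β) ∧ OneBox (corner γ α β) β := by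
  unfold corner
  split_ifs with h
  · obtain ⟨ha, hb, -⟩ := h.choose_spec
    have hca := Finset.card_lt_card (YoungDiagram.cells_ssubset_iff.2 ha)
    have hcb := Finset.card_lt_card (YoungDiagram.cells_ssubset_iff.2 hb)
    have h1' := h1.2
    have h2' := h2.2
    simp only [YoungDiagram.card] at h1' h2'
    refine ⟨⟨ha.le, ?_⟩, ⟨hb.le, ?_⟩⟩ <;> simp only [YoungDiagram.card] <;> omega
  · exact ⟨h1, h2⟩

/-- The growth diagram with left column the shape chain `u 0 ⊂ ⋯ ⊂ u p` (read from bottom to top)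
and top row the shape chain `t 0 ⊂ t 1 ⊂ ⋯` (read from left to right), where `u p = t 0`.
The shape `growth u p t k j` is the one in column `j` of the row lying `k` steps below the
top row; the rows are filled in from the top to the bottom, each from left to right, by the local
rule. The bottom row is `k = p`. -/
noncomputable def growth (u : ℕ → YoungDiagram) (p : ℕ) (t : ℕ → YoungDiagram) :
    ℕ → ℕ → YoungDiagram
  | 0, j => t j
  | k + 1, 0 => u (p - (k + 1))
  | k + 1, j + 1 => corner (growth u p t (k + 1) j) (growth u p t k j) (growth u p t k (j + 1))

section Growth

variable {u t : ℕ → YoungDiagram} {p q : ℕ}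

theorem growth_left (hut : u p = t 0) (k : ℕ) : growth u p t k 0 = u (p - k) := by
  cases k with
  | zero => rw [growth, Nat.sub_zero, hut]
  | succ k => rw [growth]

theorem growth_edges (hu : ∀ i < p, OneBox (u i) (u (i + 1)))
    (ht : ∀ j < q, OneBox (t j) (t (j + 1))) (hut : u p = t 0) (k : ℕ) (hk : k ≤ p) :
    (∀ j < q, OneBox (growth u p t k j) (growth u p t k (j + 1))) ∧
    (k < p → ∀ j ≤ q, OneBox (growth u p t (k + 1) j) (growth u p t k j)) := by
  have step : ∀ k < p, (∀ j < q, OneBox (growth u p t k j) (growth u p t k (j + 1))) →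
      ∀ j ≤ q, OneBox (growth u p t (k + 1) j) (growth u p t k j) := by
    intro k hk hrow j
    induction j with
    | zero =>
      intro _
      rw [growth_left hut, growth_left hut]
      have := hu (p - (k + 1)) (by omega)
      rwa [show p - (k + 1) + 1 = p - k by omega] at this
    | succ j ih =>
      intro hj
      rw [growth]
      exact (corner_oneBox (ih (by omega)) (hrow j (by omega))).2
  induction k with
  | zero =>
    have hrow : ∀ j < q, OneBox (growth u p t 0 j) (growth u p t 0 (j + 1)) := by
      intro j hj
      rw [growth, growth]
      exact ht j hj
    exact ⟨hrow, fun h => step 0 h hrow⟩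
  | succ k ih =>
    obtain ⟨h1, h2⟩ := ih (by omega)
    have hrow : ∀ j < q, OneBox (growth u p t (k + 1) j) (growth u p t (k + 1) (j + 1)) := by
      intro j hj
      rw [growth]
      exact (corner_oneBox (h2 (by omega) j hj.le) (h1 j hj)).1
    exact ⟨hrow, fun h => step (k + 1) h hrow⟩

end Growth

section Infusion

variable {lam mu nu : YoungDiagram}

/-- The growth diagram of a pair `(U, T)` of tableaux of shapes `mu / lam` and `nu / mu`: its left
column is the shape chain of `U` and its top row is the shape chain of `T`. -/
noncomputable def growthOf (U : SYT lam mu) (T : SYT mu nu) : ℕ → ℕ → YoungDiagram :=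
  growth U.chain U.size T.chain

theorem growthOf_edges (U : SYT lam mu) (T : SYT mu nu) (k : ℕ) (hk : k ≤ U.size) :
    (∀ j < T.size, OneBox (growthOf U T k j) (growthOf U T k (j + 1))) ∧
    (k < U.size → ∀ j ≤ T.size, OneBox (growthOf U T (k + 1) j) (growthOf U T k j)) :=
  growth_edges (fun _ => U.chain_oneBox) (fun _ => T.chain_oneBox)
    (by rw [U.chain_size, T.chain_zero]) k hk

/-- The bottom right corner of the growth diagram of `(U, T)`: the shape at which the two
tableaux of `infusion (U, T)` meet. -/
noncomputable def infusionShape (U : SYT lam mu) (T : SYT mu nu) : YoungDiagram :=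
  growthOf U T U.size T.size

/-- `infusion₁ (U, T)`: the bottom row of the growth diagram, read from left to right. -/
noncomputable def infusion1 (U : SYT lam mu) (T : SYT mu nu) : SYT lam (infusionShape U T) :=
  SYT.ofChain (fun j => growthOf U T U.size j) T.size
    (growthOf_edges U T U.size le_rfl).1
    (by rw [growthOf, growth_left (by rw [U.chain_size, T.chain_zero]), Nat.sub_self,
      U.chain_zero])
    rfl

/-- `infusion₂ (U, T)`: the right column of the growth diagram, read from bottom to top. -/
noncomputable def infusion2 (U : SYT lam mu) (T : SYT mu nu) : SYT (infusionShape U T) nu :=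
  SYT.ofChain (fun i => growthOf U T (U.size - i) T.size) U.size
    (fun i hi => by
      have h := (growthOf_edges U T (U.size - (i + 1)) (by omega)).2 (by omega) T.size le_rfl
      rwa [show U.size - (i + 1) + 1 = U.size - i by omega] at h)
    (by rw [Nat.sub_zero]; rfl)
    (by rw [Nat.sub_self, growthOf, growth, T.chain_size])

end Infusion

/-- A layered tableau `A ⋆ B ⋆ C` of shape `Lam`: standard tableaux `A`, `B`, `C` of respective
shapes `α` (a straight shape), `γ / α` and `Lam / γ`. -/
structure LayeredTableau (Lam : YoungDiagram) where
  α : YoungDiagram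
  γ : YoungDiagram
  A : SYT ⊥ α
  B : SYT α γ
  C : SYT γ Lam

namespace LayeredTableau

variable {Lam : YoungDiagram}

/-- `A ⋆ B ⋆ C ↦ infusion₁ (A, B) ⋆ infusion₂ (A, B) ⋆ C`. -/
noncomputable def I1 (X : LayeredTableau Lam) : LayeredTableau Lam where
  α := infusionShape X.A X.B
  γ := X.γ
  A := infusion1 X.A X.B
  B := infusion2 X.A X.B
  C := X.C

/-- `A ⋆ B ⋆ C ↦ A ⋆ infusion₁ (B, C) ⋆ infusion₂ (B, C)`. -/
noncomputable def I2 (X : LayeredTableau Lam) : LayeredTableau Lam where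
  α := X.α
  γ := infusionShape X.B X.C
  A := X.A
  B := infusion1 X.B X.C
  C := infusion2 X.B X.C

end LayeredTableau

end LayeredTableaux

/-!
A standard tableau of shape `ν / μ` is recorded by its content word: the list of the contents
(column minus row) of the boxes, in the order of their labels. In this language Fomin's local rule
is the operation `localSwap` on two neighbouring letters: they are exchanged unless they differ by
one. A growth diagram is then computed by `switch u t`, which moves the word `t` to the left through
the word `u`, and a layered tableau becomes a triple of words. Since `localSwap` is an involution,
so is `switch`, and with it each of the two operators (`switch_switch`). Given this, the braid
identity is the statement that the product `R` of the two operators satisfies `R ^ 3 = 1`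
(`switch_three_rotations`).

The main tool is Haiman's dual equivalence, which on content words is Knuth equivalence. Replacing
`u` by an equivalent word does not change the first component of `switch u t` and changes the second
one only up to equivalence, and similarly for `t` (`KnuthEquiv.switch_left`,
`KnuthEquiv.switch_right`); this reduces to the case of three letters against one. All content words
of tableaux of one straight shape are equivalent (`KnuthEquiv.of_path_bot`), because between two
removable corners of a shape there is, after their removal, a third one whose content lies strictly
between. Hence the rectification of a tableau, its image under switching with any tableau that fills
the inner shape, is well defined, and switching preserves it. Two equivalent words with the same
inner shape and the same rectification are equal (`Rectifies.eq_of_knuthEquiv`).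

The rectangle enters through the complement of a shape, which reverses inclusions. It shows that all
content words of tableaux of shape `Λ / μ` are equivalent as well
(`KnuthEquiv.of_path_rectangle`). Consequently the shape to which a tableau of shape `Λ / α`
rectifies depends on `α` only. It is the complement of `α` (`IsDualShape.eq_complement`): this is
proved by adding the boxes of `α` one at a time, where the descents of the words, which switching
preserves, decide between the possible contents. It follows that promotion of tableaux of shape `Λ`
has order dividing the number of boxes (`promote_iterate_length`).

Now `R` carries `(a, b, c)` to `(b', c', a')`, and up to equivalence of the layers this is promotion
iterated once for each letter of `a`. So `R ^ 3` is, up to equivalence, promotion iterated once for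
each box of `Λ`, which is the identity. As `R ^ 3` also preserves the rectification of every layer,
it is the identity itself.
-/

namespace LayeredTableaux

/-! ### Switching of words -/

/-- Fomin's local rule on the contents of two boxes added one after the other: the other order of
adding boxes, if there is one, and the same order if the contents are adjacent. -/
def localSwap (x y : ℤ) : ℤ × ℤ :=
  if x = y + 1 ∨ y = x + 1 then (x, y) else (y, x)

theorem localSwap_localSwap (x y : ℤ) :
    localSwap (localSwap x y).1 (localSwap x y).2 = (x, y) := by
  unfold localSwap
  split_ifs <;> grind

/-- Move the letter `x` to the right through a word by local swaps. The result is the new word and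
the letter that comes out on the right. -/
def pass (x : ℤ) : List ℤ → List ℤ × ℤ
  | [] => ([], x)
  | y :: w => ((localSwap x y).1 :: (pass (localSwap x y).2 w).1, (pass (localSwap x y).2 w).2)

/-- Move the word `t` to the left through the word `u` by local swaps. In a growth diagram whose
left column has the contents `u` and whose top row has the contents `t`, the two components of
`switch u t` are the contents along the bottom row and the right column. -/
def switch : List ℤ → List ℤ → List ℤ × List ℤ
  | [], t => (t, [])
  | x :: u, t => ((pass x (switch u t).1).1, (pass x (switch u t).1).2 :: (switch u t).2)

theorem pass_append (x : ℤ) (s t : List ℤ) :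
    pass x (s ++ t) = ((pass x s).1 ++ (pass (pass x s).2 t).1, (pass (pass x s).2 t).2) := by
  induction s generalizing x with
  | nil => simp [pass]
  | cons y s ih => simp [pass, ih]

theorem length_pass (x : ℤ) (t : List ℤ) : (pass x t).1.length = t.length := by
  induction t generalizing x with
  | nil => rfl
  | cons y t ih => simp [pass, ih]

@[simp]
theorem switch_nil_left (t : List ℤ) : switch [] t = (t, []) := rfl

@[simp]
theorem switch_nil_right (u : List ℤ) : switch u [] = ([], u) := by
  induction u with
  | nil => rfl
  | cons x u ih => simp [switch, ih, pass]

theorem switch_singleton_left (x : ℤ) (t : List ℤ) :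
    switch [x] t = ((pass x t).1, [(pass x t).2]) := rfl

theorem switch_append_left (u v t : List ℤ) :
    switch (u ++ v) t = ((switch u (switch v t).1).1,
      (switch u (switch v t).1).2 ++ (switch v t).2) := by
  induction u with
  | nil => simp
  | cons x u ih => simp [switch, ih]

theorem switch_append_right (u s t : List ℤ) :
    switch u (s ++ t) = ((switch u s).1 ++ (switch (switch u s).2 t).1,
      (switch (switch u s).2 t).2) := by
  induction u with
  | nil => simp
  | cons x u ih => simp [switch, ih, pass_append]

theorem length_switch_fst (u t : List ℤ) : (switch u t).1.length = t.length := by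
  induction u with
  | nil => rfl
  | cons x u ih => simp [switch, length_pass, ih]

theorem switch_pass (x : ℤ) (w : List ℤ) : switch (pass x w).1 [(pass x w).2] = ([x], w) := by
  induction w generalizing x with
  | nil => rfl
  | cons y w ih =>
    simp only [pass, switch, ih]
    have h := localSwap_localSwap x y
    simp only [h]

theorem switch_switch (u t : List ℤ) : switch (switch u t).1 (switch u t).2 = (u, t) := by
  induction u with
  | nil => simp
  | cons x u ih =>
    have h := switch_append_right (switch (x :: u) t).1 [(pass x (switch u t).1).2] (switch u t).2
    simp only [switch, List.singleton_append, switch_pass, ih] at h ⊢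
    exact h

/-! ### Knuth equivalence -/

/-- The two Knuth relations on words of three letters: two neighbouring letters are exchanged when
the third letter lies strictly between them. -/
inductive KnuthTriple : List ℤ → List ℤ → Prop
  | left {x y z : ℤ} (h : x < z ∧ z < y ∨ y < z ∧ z < x) : KnuthTriple [x, y, z] [y, x, z]
  | right {x y z : ℤ} (h : y < x ∧ x < z ∨ z < x ∧ x < y) : KnuthTriple [x, y, z] [x, z, y]

theorem KnuthTriple.symm {l l' : List ℤ} (h : KnuthTriple l l') : KnuthTriple l' l := by
  cases h with
  | left h => exact .left h.symm
  | right h => exact .right h.symm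

/-- One Knuth relation applied to three consecutive letters of a word. -/
def KnuthStep (w w' : List ℤ) : Prop :=
  ∃ p l l' q, KnuthTriple l l' ∧ w = p ++ (l ++ q) ∧ w' = p ++ (l' ++ q)

/-- Knuth equivalence. On content words of tableaux this is dual equivalence. The reflexive
transitive closure is already symmetric, since a Knuth step can be undone. -/
def KnuthEquiv : List ℤ → List ℤ → Prop := Relation.ReflTransGen KnuthStep

theorem KnuthStep.symm {w w' : List ℤ} (h : KnuthStep w w') : KnuthStep w' w := by
  obtain ⟨p, l, l', q, h, rfl, rfl⟩ := h
  exact ⟨p, l', l, q, h.symm, rfl, rfl⟩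

theorem KnuthEquiv.refl (w : List ℤ) : KnuthEquiv w w := Relation.ReflTransGen.refl

theorem KnuthEquiv.symm {w w' : List ℤ} (h : KnuthEquiv w w') : KnuthEquiv w' w :=
  by
  induction h with
  | refl => exact Relation.ReflTransGen.refl
  | tail _ h ih => exact ih.head h.symm

theorem KnuthEquiv.trans {u v w : List ℤ} (h : KnuthEquiv u v) (h' : KnuthEquiv v w) :
    KnuthEquiv u w := Relation.ReflTransGen.trans h h'

theorem KnuthEquiv.append {u u' v v' : List ℤ} (h : KnuthEquiv u u') (h' : KnuthEquiv v v') :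
    KnuthEquiv (u ++ v) (u' ++ v') := by
  have h1 : KnuthEquiv (u ++ v) (u' ++ v) := by
    refine Relation.ReflTransGen.lift (p := KnuthStep) (fun w => w ++ v) ?_ _ _ h
    rintro _ _ ⟨p, l, l', q, h, rfl, rfl⟩
    exact ⟨p, l, l', q ++ v, h, by simp, by simp⟩
  have h2 : KnuthEquiv (u' ++ v) (u' ++ v') := by
    refine Relation.ReflTransGen.lift (p := KnuthStep) (fun w => u' ++ w) ?_ _ _ h'
    rintro _ _ ⟨p, l, l', q, h, rfl, rfl⟩
    exact ⟨u' ++ p, l, l', q, h, by simp, by simp⟩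
  exact h1.trans h2

theorem KnuthTriple.equiv {l l' : List ℤ} (h : KnuthTriple l l') : KnuthEquiv l l' :=
  Relation.ReflTransGen.single ⟨[], l, l', [], h, by simp, by simp⟩

/-! ### Three letters against one

The assumptions on the letter `t` are those which hold for the content word of a chain of shapes.
-/

theorem switch_triple_left_letter {x y z t : ℤ} (h : x < z ∧ z < y ∨ y < z ∧ z < x)
    (hx : t ≠ x) (hy : t ≠ y) (hz : t ≠ z) :
    (switch [x, y, z] [t]).1 = (switch [y, x, z] [t]).1 ∧
      KnuthTriple (switch [x, y, z] [t]).2 (switch [y, x, z] [t]).2 := by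
  simp only [switch, pass, localSwap]
  split_ifs <;> dsimp only at * <;>
  first
  | (exfalso; omega)
  | (refine ⟨rfl, .left ?_⟩; omega)

theorem switch_triple_right_letter {x y z t : ℤ} (h : y < x ∧ x < z ∨ z < x ∧ x < y)
    (hy : t ≠ y) (hz : t ≠ z)
    (hx : t = x → (y = x + 1 ∧ z = x - 1) ∨ (z = x + 1 ∧ y = x - 1)) :
    (switch [x, y, z] [t]).1 = (switch [x, z, y] [t]).1 ∧
      KnuthTriple (switch [x, y, z] [t]).2 (switch [x, z, y] [t]).2 := by
  simp only [switch, pass, localSwap]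
  split_ifs <;> dsimp only at * <;>
  first
  | (exfalso; omega)
  | (refine ⟨rfl, .left ?_⟩; omega)
  | (refine ⟨rfl, .right ?_⟩; omega)

theorem switch_letter_triple_left {x y z t : ℤ} (h : x < z ∧ z < y ∨ y < z ∧ z < x)
    (hx : t ≠ x) (hy : t ≠ y)
    (hz : t = z → (y = z + 1 ∧ x = z - 1) ∨ (x = z + 1 ∧ y = z - 1)) :
    (switch [t] [x, y, z]).2 = (switch [t] [y, x, z]).2 ∧
      KnuthTriple (switch [t] [x, y, z]).1 (switch [t] [y, x, z]).1 := by
  simp only [switch, pass, localSwap]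
  split_ifs <;> dsimp only at * <;>
  first
  | (exfalso; omega)
  | (refine ⟨rfl, .left ?_⟩; omega)
  | (refine ⟨rfl, .right ?_⟩; omega)

theorem switch_letter_triple_right {x y z t : ℤ} (h : y < x ∧ x < z ∨ z < x ∧ x < y)
    (hx : t ≠ x) (hy : t ≠ y) (hz : t ≠ z) :
    (switch [t] [x, y, z]).2 = (switch [t] [x, z, y]).2 ∧
      KnuthTriple (switch [t] [x, y, z]).1 (switch [t] [x, z, y]).1 := by
  simp only [switch, pass, localSwap]
  split_ifs <;> dsimp only at * <;>
  first
  | (exfalso; omega)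
  | (refine ⟨rfl, .right ?_⟩; omega)

/-- A descent is preserved when a letter moves through it from the right. -/
theorem switch_pair_letter_lt {x y t : ℤ} (hxy : x ≠ y) (hyt : y ≠ t) (hxt : x ≠ t) :
    ∃ x' y' t', switch [x, y] [t] = ([t'], [x', y']) ∧ (x' < y' ↔ x < y) := by
  simp only [switch, pass, localSwap]
  split_ifs <;> dsimp only at * <;> refine ⟨_, _, _, rfl, ?_⟩ <;> omega

/-- A descent is preserved when a letter moves through it from the left. -/
theorem switch_letter_pair_lt {x y t : ℤ} (hxy : x ≠ y) (htx : t ≠ x) (hty : t ≠ y) :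
    ∃ x' y' t', switch [t] [x, y] = ([x', y'], [t']) ∧ (x' < y' ↔ x < y) := by
  simp only [switch, pass, localSwap]
  split_ifs <;> dsimp only at * <;> refine ⟨_, _, _, rfl, ?_⟩ <;> omega

/-! ### Content words of chains of shapes -/

/-- The shape `ν` arises from the shape `μ` by adding one box, of content (column minus row) `x`. -/
def AddBox (μ : YoungDiagram) (x : ℤ) (ν : YoungDiagram) : Prop :=
  ∃ i j : ℕ, (j : ℤ) - i = x ∧ (i, j) ∉ μ ∧ ∀ d, d ∈ ν ↔ d = (i, j) ∨ d ∈ μ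

namespace AddBox

variable {γ μ ν δ α β : YoungDiagram} {x y z t : ℤ}

theorem le (h : AddBox μ x ν) : μ ≤ ν := by
  obtain ⟨i, j, -, -, h⟩ := h
  exact fun d hd => (h d).2 (Or.inr hd)

theorem cells_eq {i j : ℕ} (h : ∀ d, d ∈ ν ↔ d = (i, j) ∨ d ∈ μ) :
    ν.cells = insert (i, j) μ.cells := by
  ext d
  simp only [Finset.mem_insert, YoungDiagram.mem_cells, h]

theorem card (h : AddBox μ x ν) : ν.card = μ.card + 1 := by
  obtain ⟨i, j, -, h0, h⟩ := h
  simp only [YoungDiagram.card]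
  rw [cells_eq h, Finset.card_insert_of_notMem]
  simpa using h0

theorem _root_.LayeredTableaux.OneBox.exists_addBox (h : OneBox μ ν) : ∃ x, AddBox μ x ν := by
  obtain ⟨hle, hc⟩ := h
  have hsub : μ.cells ⊆ ν.cells := hle
  have h1 : (ν.cells \ μ.cells).card = 1 := by
    rw [Finset.card_sdiff_of_subset hsub]
    simp only [YoungDiagram.card] at hc
    omega
  obtain ⟨⟨i, j⟩, hij⟩ := Finset.card_eq_one.1 h1
  have hmem : ∀ d, d ∈ ν ∧ d ∉ μ ↔ d = (i, j) := fun d => by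
    rw [← YoungDiagram.mem_cells, ← YoungDiagram.mem_cells, ← Finset.mem_sdiff, hij,
      Finset.mem_singleton]
  refine ⟨j - i, i, j, rfl, ((hmem _).2 rfl).2, fun d => ?_⟩
  by_cases hd : d ∈ μ
  · simp [hd, hle hd]
  · rw [← hmem d]
    simp [hd]

/-- Two boxes of the same content are comparable, and so they cannot both be addable. -/
theorem unique (h : AddBox μ x ν) (h' : AddBox μ x δ) : ν = δ := by
  obtain ⟨i, j, hx, h0, h⟩ := h
  obtain ⟨i', j', hx', h0', h'⟩ := h'
  have key : i = i' := by
    rcases lt_trichotomy i i' with hlt | heq | hlt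
    · have h1 : (i, j) ∈ δ := δ.up_left_mem hlt.le (by omega) ((h' (i', j')).2 (Or.inl rfl))
      rcases (h' _).1 h1 with h2 | h2
      · simp only [Prod.mk.injEq] at h2; omega
      · exact absurd h2 h0
    · exact heq
    · have h1 : (i', j') ∈ ν := ν.up_left_mem hlt.le (by omega) ((h (i, j)).2 (Or.inl rfl))
      rcases (h _).1 h1 with h2 | h2
      · simp only [Prod.mk.injEq] at h2; omega
      · exact absurd h2 h0'
  have key' : j = j' := by omega
  subst key key'
  exact SetLike.ext fun d => by rw [h, h']

/-- Two removable boxes of the same content are comparable, hence equal. -/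
theorem unique_left (h : AddBox μ x ν) (h' : AddBox δ x ν) : μ = δ := by
  obtain ⟨i, j, hx, h0, h⟩ := h
  obtain ⟨i', j', hx', h0', h'⟩ := h'
  have key : i = i' := by
    rcases lt_trichotomy i i' with hlt | heq | hlt
    · have h1 : (i', j') ∈ μ := by
        rcases (h _).1 ((h' (i', j')).2 (Or.inl rfl)) with h2 | h2
        · simp only [Prod.mk.injEq] at h2; omega
        · exact h2
      exact absurd (μ.up_left_mem hlt.le (by omega) h1) h0
    · exact heq
    · have h1 : (i, j) ∈ δ := by
        rcases (h' _).1 ((h (i, j)).2 (Or.inl rfl)) with h2 | h2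
        · simp only [Prod.mk.injEq] at h2; omega
        · exact h2
      exact absurd (δ.up_left_mem hlt.le (by omega) h1) h0'
  have key' : j = j' := by omega
  subst key key'
  refine SetLike.ext fun d => ?_
  have := (h d).symm.trans (h' d)
  by_cases hd : d = (i, j)
  · subst hd; simp [h0, h0']
  · simpa [hd] using this

/-- Two addable boxes never have adjacent contents. -/
theorem not_adjacent (h : AddBox μ x ν) (h' : AddBox μ y δ) : y ≠ x + 1 := by
  obtain ⟨i, j, hx, h0, h⟩ := h
  obtain ⟨i', j', hx', h0', h'⟩ := h'
  intro hxy
  by_cases hle : i ≤ i'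
  · have h1 : (i, j) ∈ δ := δ.up_left_mem hle (by omega) ((h' (i', j')).2 (Or.inl rfl))
    rcases (h' _).1 h1 with h2 | h2
    · simp only [Prod.mk.injEq] at h2; omega
    · exact absurd h2 h0
  · have h1 : (i', j') ∈ ν := ν.up_left_mem (by omega) (by omega) ((h (i, j)).2 (Or.inl rfl))
    rcases (h _).1 h1 with h2 | h2
    · simp only [Prod.mk.injEq] at h2; omega
    · exact absurd h2 h0'

/-- Boxes of non-adjacent contents can be added in either order. -/
theorem swap (h : AddBox γ x α) (h' : AddBox α y β) (h1 : x ≠ y + 1) (h2 : y ≠ x + 1) :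
    ∃ δ, AddBox γ y δ ∧ AddBox δ x β := by
  obtain ⟨i, j, hx, h0, h⟩ := h
  obtain ⟨i', j', hy, h0', h'⟩ := h'
  have hne : (i', j') ≠ (i, j) := fun e => h0' ((h _).2 (Or.inl e))
  have hγ : (i', j') ∉ γ := fun e => h0' ((h _).2 (Or.inr e))
  -- the box `(i, j)` is not weakly northwest of `(i', j')`
  have hnot : ¬ (i ≤ i' ∧ j ≤ j') := by
    rintro ⟨hi, hj⟩
    have hmem : ∀ a b, a ≤ i' → b ≤ j' → (a, b) ≠ (i', j') → (a, b) ≠ (i, j) → (a, b) ∈ γ := by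
      intro a b ha hb hab hab'
      have e1 : (a, b) ∈ β := β.up_left_mem ha hb ((h' (i', j')).2 (Or.inl rfl))
      exact ((h _).1 (((h' _).1 e1).resolve_left hab)).resolve_left hab'
    simp only [ne_eq, Prod.mk.injEq, not_and] at hne hmem
    by_cases hi' : i < i'
    · exact h0 (γ.up_left_mem (Nat.le_succ i) le_rfl
        (hmem (i + 1) j hi' hj (by omega) (by omega)))
    · exact h0 (γ.up_left_mem le_rfl (Nat.le_succ j)
        (hmem i (j + 1) hi (by omega) (by omega) (by omega)))
  let δ : YoungDiagram :=
    { cells := insert (i', j') γ.cells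
      isLowerSet := by
        rintro ⟨a, b⟩ ⟨c, d⟩ ⟨hca, hdb⟩ hab
        simp only at hca hdb
        simp only [Finset.coe_insert, Set.mem_insert_iff, Finset.mem_coe,
          YoungDiagram.mem_cells] at hab ⊢
        rcases hab with e | e
        · simp only [Prod.mk.injEq] at e
          obtain ⟨rfl, rfl⟩ := e
          by_cases hcd : (c, d) = (a, b)
          · exact Or.inl hcd
          · have e1 : (c, d) ∈ β := β.up_left_mem hca hdb ((h' (a, b)).2 (Or.inl rfl))
            refine Or.inr (((h _).1 (((h' _).1 e1).resolve_left hcd)).resolve_left ?_)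
            intro e2
            simp only [Prod.mk.injEq] at e2
            exact hnot ⟨by omega, by omega⟩
        · exact Or.inr (γ.up_left_mem hca hdb e) }
  have hδ : ∀ d, d ∈ δ ↔ d = (i', j') ∨ d ∈ γ := fun d => by
    rw [← YoungDiagram.mem_cells, Finset.mem_insert, YoungDiagram.mem_cells]
  refine ⟨δ, ⟨i', j', hy, hγ, hδ⟩, ⟨i, j, hx, ?_, fun d => ?_⟩⟩
  · rw [hδ]
    rintro (e | e)
    · exact hne e.symm
    · exact h0 e
  · rw [h', h, hδ]
    tauto

end AddBox

/-- There is a chain of shapes from `μ` to `ν`, adding one box at a time, whose boxes have the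
contents listed in `w`. The words `w` with `Path μ w ν` correspond to the standard tableaux of shape
`ν / μ`. -/
def Path : YoungDiagram → List ℤ → YoungDiagram → Prop
  | μ, [], ν => μ = ν
  | μ, x :: w, ν => ∃ κ, AddBox μ x κ ∧ Path κ w ν

namespace Path

variable {γ μ ν δ κ : YoungDiagram} {x y z t : ℤ} {u v w : List ℤ}

@[simp]
theorem nil_iff : Path μ [] ν ↔ μ = ν := Iff.rfl

theorem cons_iff : Path μ (x :: w) ν ↔ ∃ κ, AddBox μ x κ ∧ Path κ w ν := Iff.rfl

theorem singleton_iff : Path μ [x] ν ↔ AddBox μ x ν := by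
  simp [cons_iff]

theorem append_iff : Path μ (u ++ v) ν ↔ ∃ κ, Path μ u κ ∧ Path κ v ν := by
  induction u generalizing μ with
  | nil => simp
  | cons x u ih =>
    simp only [List.cons_append, cons_iff, ih]
    constructor
    · rintro ⟨κ, h, κ', h1, h2⟩
      exact ⟨κ', ⟨κ, h, h1⟩, h2⟩
    · rintro ⟨κ', ⟨κ, h, h1⟩, h2⟩
      exact ⟨κ, h, κ', h1, h2⟩

theorem append (h : Path μ u κ) (h' : Path κ v ν) : Path μ (u ++ v) ν :=
  append_iff.2 ⟨κ, h, h'⟩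

theorem le (h : Path μ w ν) : μ ≤ ν := by
  induction w generalizing μ with
  | nil => exact (nil_iff.1 h).le
  | cons x w ih =>
    obtain ⟨κ, h1, h2⟩ := h
    exact h1.le.trans (ih h2)

theorem card (h : Path μ w ν) : ν.card = μ.card + w.length := by
  induction w generalizing μ with
  | nil => simp [nil_iff.1 h]
  | cons x w ih =>
    obtain ⟨κ, h1, h2⟩ := h
    rw [ih h2, h1.card, List.length_cons]
    omega

theorem unique (h : Path μ w ν) (h' : Path μ w δ) : ν = δ := by
  induction w generalizing μ with
  | nil => exact (nil_iff.1 h).symm.trans (nil_iff.1 h')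
  | cons x w ih =>
    obtain ⟨κ, h1, h2⟩ := h
    obtain ⟨κ', h1', h2'⟩ := h'
    obtain rfl := h1.unique h1'
    exact ih h2 h2'

theorem unique_left (h : Path μ w ν) (h' : Path δ w ν) : μ = δ := by
  induction w generalizing μ δ with
  | nil => exact (nil_iff.1 h).trans (nil_iff.1 h').symm
  | cons x w ih =>
    obtain ⟨κ, h1, h2⟩ := h
    obtain ⟨κ', h1', h2'⟩ := h'
    obtain rfl := ih h2 h2'
    exact h1.unique_left h1'

theorem localSwap (h : Path μ [x, y] ν) :
    Path μ [(localSwap x y).1, (localSwap x y).2] ν := by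
  unfold LayeredTableaux.localSwap
  split_ifs with hadj
  · exact h
  · obtain ⟨κ, h1, h2⟩ := h
    obtain ⟨δ, h3, h4⟩ := h1.swap (singleton_iff.1 h2) (by omega) (by omega)
    exact ⟨δ, h3, singleton_iff.2 h4⟩

theorem pass (h : Path μ (x :: w) ν) : Path μ ((pass x w).1 ++ [(pass x w).2]) ν := by
  induction w generalizing x μ with
  | nil => exact h
  | cons y w ih =>
    obtain ⟨κ, h1, h2⟩ := append_iff.1 (show Path μ ([x, y] ++ w) ν from h)
    obtain ⟨δ, h3, h4⟩ := h1.localSwap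
    have h5 : Path δ ((LayeredTableaux.localSwap x y).2 :: w) ν :=
      (singleton_iff.2 (singleton_iff.1 h4)).append h2
    exact ⟨δ, h3, ih h5⟩

theorem switch (h : Path μ (u ++ w) ν) :
    Path μ ((switch u w).1 ++ (switch u w).2) ν := by
  induction u generalizing μ with
  | nil => simpa using h
  | cons x u ih =>
    obtain ⟨κ, h1, h2⟩ := h
    obtain ⟨κ', h3, h4⟩ := append_iff.1 (ih h2)
    have h5 : Path μ (x :: (LayeredTableaux.switch u w).1) κ' := ⟨κ, h1, h3⟩
    have h6 := h5.pass.append h4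
    simpa [LayeredTableaux.switch] using h6

/-- Between two boxes of content `x`, boxes of the contents `x - 1` and `x + 1` are added. -/
theorem mem_of_same_content (h : Path μ (x :: (w ++ [x])) ν) : x + 1 ∈ w ∧ x - 1 ∈ w := by
  have key : ∀ {w : List ℤ} {κ κ' : YoungDiagram} (_ : Path κ w κ') {a b : ℕ}, (a, b) ∈ κ' →
      (a, b) ∉ κ → ((b : ℤ) - a) ∈ w := by
    intro w
    induction w with
    | nil =>
      intro κ κ' hp a b hm hn
      rw [nil_iff.1 hp] at hn
      exact absurd hm hn
    | cons z w ih =>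
      intro κ κ' hp a b hm hn
      obtain ⟨κ₁, ⟨i, j, hz, h0, h1⟩, h2⟩ := hp
      by_cases hab : (a, b) ∈ κ₁
      · rcases (h1 _).1 hab with e | e
        · simp only [Prod.mk.injEq] at e
          rw [e.1, e.2, hz]
          exact List.mem_cons_self
        · exact absurd e hn
      · exact List.mem_cons_of_mem _ (ih h2 hm hab)
  obtain ⟨κ, ⟨i, j, hx, h0, h1⟩, h2⟩ := h
  obtain ⟨κ', h3, h4⟩ := append_iff.1 h2
  obtain ⟨i', j', hx', h0', h1'⟩ := singleton_iff.1 h4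
  have hlt : i < i' := by
    by_contra hle
    exact h0' (h3.le (κ.up_left_mem (by omega) (by omega) ((h1 (i, j)).2 (Or.inl rfl))))
  have hm : ∀ a b, a ≤ i' → b ≤ j' → ¬ (a = i' ∧ b = j') → (a, b) ∈ κ' := by
    intro a b ha hb hab
    have := ν.up_left_mem ha hb ((h1' (i', j')).2 (Or.inl rfl))
    simpa [h1', hab] using this
  have hn : ∀ a b, i ≤ a → j ≤ b → ¬ (a = i ∧ b = j) → (a, b) ∉ κ := by
    intro a b ha hb hab hmem
    simp only [h1, Prod.mk.injEq, hab, false_or] at hmem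
    exact h0 (μ.up_left_mem ha hb hmem)
  constructor
  · have := key h3 (hm i (j + 1) (by omega) (by omega) (by omega))
      (hn i (j + 1) (by omega) (by omega) (by omega))
    push_cast at this
    rwa [show (j : ℤ) + 1 - i = x + 1 by omega] at this
  · have := key h3 (hm (i + 1) j (by omega) (by omega) (by omega))
      (hn (i + 1) j (by omega) (by omega) (by omega))
    push_cast at this
    rwa [show (j : ℤ) - (i + 1) = x - 1 by omega] at this

end Path

/-! ### Removable corners -/

section Extend
variable {γ μ ν δ α β κ κ' : YoungDiagram} {p q : ℤ}

theorem exists_addBox_of_corner {a b : ℕ} (h : (a, b) ∈ δ) (h1 : (a + 1, b) ∉ δ)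
    (h2 : (a, b + 1) ∉ δ) : ∃ ρ : YoungDiagram, AddBox ρ ((b : ℤ) - a) δ ∧ (a, b) ∉ ρ := by
  let ρ : YoungDiagram :=
    { cells := δ.cells.erase (a, b)
      isLowerSet := by
        rintro ⟨c, d⟩ ⟨e, f⟩ ⟨hec, hfd⟩ hcd
        simp only at hec hfd
        simp only [Finset.coe_erase, Set.mem_sdiff, Finset.mem_coe, YoungDiagram.mem_cells,
          Set.mem_singleton_iff] at hcd ⊢
        refine ⟨δ.up_left_mem hec hfd hcd.1, ?_⟩
        intro hef
        simp only [Prod.mk.injEq] at hef hcd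
        obtain ⟨rfl, rfl⟩ := hef
        by_cases hc : e < c
        · exact h1 (δ.up_left_mem hc hfd hcd.1)
        · exact h2 (δ.up_left_mem hec (show f + 1 ≤ d by omega) hcd.1) }
  have hρ : ∀ d, d ∈ ρ ↔ d ≠ (a, b) ∧ d ∈ δ := fun d => by
    rw [← YoungDiagram.mem_cells, Finset.mem_erase, YoungDiagram.mem_cells]
  refine ⟨ρ, ⟨a, b, rfl, by simp [hρ], fun d => ?_⟩, by simp [hρ]⟩
  rw [hρ]
  by_cases hd : d = (a, b)
  · simp [hd, h]
  · simp [hd]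

theorem Path.exists_of_le (h : κ ≤ μ) : ∃ w, Path κ w μ := by
  -- a box of `μ` outside `κ` with the largest sum of coordinates is removable
  induction hn : μ.card generalizing μ with
  | zero =>
    refine ⟨[], ?_⟩
    have : μ = ⊥ := YoungDiagram.ext (by simpa [YoungDiagram.card] using hn)
    subst this
    exact le_antisymm h bot_le
  | succ n ih =>
    by_cases heq : κ = μ
    · exact ⟨[], heq⟩
    · have hne : (μ.cells \ κ.cells).Nonempty := by
        rw [Finset.sdiff_nonempty]
        intro hle
        exact heq (le_antisymm h hle)
      obtain ⟨⟨a, b⟩, hab, hmax⟩ :=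
        Finset.exists_max_image _ (fun d : ℕ × ℕ => d.1 + d.2) hne
      simp only [Finset.mem_sdiff, YoungDiagram.mem_cells, Prod.forall] at hab hmax
      obtain ⟨ρ, hρ, hρ'⟩ := exists_addBox_of_corner hab.1
        (fun e => by
          have := hmax (a + 1) b ⟨e, fun e' => hab.2 (κ.up_left_mem (by omega) le_rfl e')⟩
          omega)
        (fun e => by
          have := hmax a (b + 1) ⟨e, fun e' => hab.2 (κ.up_left_mem le_rfl (by omega) e')⟩
          omega)
      have hle : κ ≤ ρ := by
        intro d hd
        obtain ⟨i, j, -, -, hm⟩ := id hρ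
        have hij : (i, j) = (a, b) := by
          by_contra hne'
          exact hρ' (((hm (a, b)).1 hab.1).resolve_left (Ne.symm hne'))
        rcases (hm d).1 (h hd) with e | e
        · exact absurd (e.trans hij ▸ hd) hab.2
        · exact e
      have hc := hρ.card
      obtain ⟨w, hw⟩ := ih hle (by omega)
      exact ⟨w ++ [_], hw.append (Path.singleton_iff.2 hρ)⟩

theorem AddBox.exists_inter (h : AddBox κ p μ) (h' : AddBox κ' q μ) (hpq : p ≠ q) :
    ∃ δ, AddBox δ q κ ∧ AddBox δ p κ' := by
  obtain ⟨i, j, hp, h0, h1⟩ := h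
  obtain ⟨i', j', hq, h0', h1'⟩ := h'
  have hne : (i, j) ≠ (i', j') := by
    intro e
    simp only [Prod.mk.injEq] at e
    omega
  refine ⟨κ ⊓ κ', ⟨i', j', hq, by simp [h0'], fun d => ?_⟩,
    ⟨i, j, hp, by simp [h0], fun d => ?_⟩⟩
  all_goals
    rw [YoungDiagram.mem_inf]
    have h2 := (h1 d).symm.trans (h1' d)
  · by_cases hd : d = (i, j)
    · subst hd; simp [h0, hne]
    · have h3 : d ∈ κ ↔ d = (i', j') ∨ d ∈ κ' := by simpa [hd] using h2
      tauto
  · by_cases hd : d = (i', j')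
    · subst hd; simp [h0', hne.symm]
    · have h3 : (d = (i, j) ∨ d ∈ κ) ↔ d ∈ κ' := by simpa [hd] using h2
      tauto

/-- For any two addable boxes, some removable box has its content strictly between theirs. -/
theorem exists_corner_between (h : AddBox δ q κ) (h' : AddBox δ p κ') (hqp : q < p) :
    ∃ r ρ, AddBox ρ r δ ∧ q < r ∧ r < p := by
  obtain ⟨k, l, hq, h0, h1⟩ := h
  obtain ⟨i, j, hp, h0', h1'⟩ := h'
  have hik : i < k := by
    by_contra hle
    have e : (k, l) ∈ κ' := κ'.up_left_mem (by omega) (by omega) ((h1' (i, j)).2 (Or.inl rfl))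
    rcases (h1' _).1 e with e | e
    · simp only [Prod.mk.injEq] at e; omega
    · exact h0 e
  have hkl : (k - 1, l) ∈ δ := by
    have e : (k - 1, l) ∈ κ := κ.up_left_mem (by omega) le_rfl ((h1 (k, l)).2 (Or.inl rfl))
    refine ((h1 _).1 e).resolve_left ?_
    simp only [Prod.mk.injEq]; omega
  -- the boxes of `δ` in the rows `i, …, k - 1` and in the columns from `l` on include `(k - 1, l)`;
  -- one with the largest sum of coordinates is a corner of `δ`
  obtain ⟨⟨a, b⟩, hab, hmax⟩ := Finset.exists_max_image
    (δ.cells.filter fun d => i ≤ d.1 ∧ d.1 ≤ k - 1 ∧ l ≤ d.2) (fun d : ℕ × ℕ => d.1 + d.2)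
    ⟨(k - 1, l), by simp [hkl]; omega⟩
  simp only [Finset.mem_filter, YoungDiagram.mem_cells, Prod.forall] at hab hmax
  obtain ⟨hab, hia, hak, hlb⟩ := hab
  have hbj : b < j := by
    by_contra hle
    exact h0' (δ.up_left_mem hia (by omega) hab)
  obtain ⟨ρ, hρ, -⟩ := exists_addBox_of_corner hab
    (fun e => by
      by_cases hak' : a = k - 1
      · exact h0 (δ.up_left_mem (by omega) hlb e)
      · have := hmax (a + 1) b ⟨e, by omega, by omega, hlb⟩
        omega)
    (fun e => by
      have := hmax a (b + 1) ⟨e, hia, hak, by omega⟩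
      omega)
  exact ⟨_, ρ, hρ, by omega, by omega⟩

end Extend

/-! ### Switching and Knuth equivalence -/

section Dual

variable {μ ν : YoungDiagram} {u u' t t' l l' w w' : List ℤ} {x y z : ℤ}

theorem KnuthTriple.path (h : KnuthTriple l l') (hp : Path μ l ν) : Path μ l' ν := by
  cases h with
  | @left x y z h =>
    obtain ⟨κ, h1, h2⟩ := Path.append_iff.1 (show Path μ ([x, y] ++ [z]) ν from hp)
    have h3 := h1.localSwap
    rw [localSwap, if_neg (by omega)] at h3
    exact h3.append h2
  | @right x y z h =>
    obtain ⟨κ, h1, h2⟩ := hp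
    have h3 := Path.localSwap h2
    rw [localSwap, if_neg (by omega)] at h3
    exact ⟨κ, h1, h3⟩

theorem KnuthStep.path (h : KnuthStep w w') (hp : Path μ w ν) : Path μ w' ν := by
  obtain ⟨p, l, l', q, h, rfl, rfl⟩ := h
  obtain ⟨κ, h1, h2⟩ := Path.append_iff.1 hp
  obtain ⟨κ', h3, h4⟩ := Path.append_iff.1 h2
  exact h1.append ((h.path h3).append h4)

theorem KnuthEquiv.path (h : KnuthEquiv w w') (hp : Path μ w ν) : Path μ w' ν := by
  induction h with
  | refl => exact hp
  | tail _ h ih => exact h.path ih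

theorem KnuthTriple.switch_letter (h : KnuthTriple l l') (hp : Path μ (l ++ [x]) ν) :
    (switch l [x]).1 = (switch l' [x]).1 ∧ KnuthTriple (switch l [x]).2 (switch l' [x]).2 := by
  have hp' : Path μ (l' ++ [x]) ν := by
    obtain ⟨κ, h1, h2⟩ := Path.append_iff.1 hp
    exact (h.path h1).append h2
  cases h with
  | @left a b c h =>
    have h1 := fun e : a = x => Path.mem_of_same_content (w := [b, c]) (by subst e; exact hp)
    have h1' := fun e : b = x => Path.mem_of_same_content (w := [a, c]) (by subst e; exact hp')
    obtain ⟨κ, -, κ', -, h2⟩ := hp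
    have h3 : c ≠ x := fun e => by
      simpa using (Path.mem_of_same_content (w := []) (by subst e; exact h2))
    simp only [List.mem_cons, List.not_mem_nil, or_false] at h1 h1'
    exact switch_triple_left_letter h (by omega) (by omega) (by omega)
  | @right a b c h =>
    have h1 := fun e : a = x => Path.mem_of_same_content (w := [b, c]) (by subst e; exact hp)
    obtain ⟨κ, -, h2⟩ := hp
    obtain ⟨κ', -, h2'⟩ := hp'
    have h3 := fun e : b = x => Path.mem_of_same_content (w := [c]) (by subst e; exact h2)
    have h4 := fun e : c = x => Path.mem_of_same_content (w := [b]) (by subst e; exact h2')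
    simp only [List.mem_cons, List.not_mem_nil, or_false] at h1 h3 h4
    exact switch_triple_right_letter h (by omega) (by omega) (by omega)

theorem KnuthTriple.letter_switch (h : KnuthTriple l l') (hp : Path μ (x :: l) ν) :
    (switch [x] l).2 = (switch [x] l').2 ∧ KnuthTriple (switch [x] l).1 (switch [x] l').1 := by
  have hp' : Path μ (x :: l') ν := by
    obtain ⟨κ, h1, h2⟩ := hp
    exact ⟨κ, h1, h.path h2⟩
  have two : ∀ {w v : List ℤ}, Path μ (x :: (w ++ v)) ν → ∃ ν, Path μ (x :: w) ν := by
    intro w v h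
    obtain ⟨κ, h, -⟩ := Path.append_iff.1 (show Path μ ((x :: w) ++ v) ν from h)
    exact ⟨κ, h⟩
  cases h with
  | @left a b c h =>
    have h1 := fun e : x = c => Path.mem_of_same_content (w := [a, b]) (by subst e; exact hp)
    obtain ⟨κ, h2⟩ := two (w := [a, b]) (v := [c]) hp
    obtain ⟨κ', h2'⟩ := two (w := [b, a]) (v := [c]) hp'
    have h3 := fun e : x = b => Path.mem_of_same_content (w := [a]) (by subst e; exact h2)
    have h4 := fun e : x = a => Path.mem_of_same_content (w := [b]) (by subst e; exact h2')
    simp only [List.mem_cons, List.not_mem_nil, or_false] at h1 h3 h4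
    exact switch_letter_triple_left h (by omega) (by omega) (by omega)
  | @right a b c h =>
    have h1 := fun e : x = c => Path.mem_of_same_content (w := [a, b]) (by subst e; exact hp)
    have h1' := fun e : x = b => Path.mem_of_same_content (w := [a, c]) (by subst e; exact hp')
    obtain ⟨κ, h2⟩ := two (w := [a]) (v := [b, c]) hp
    have h3 : x ≠ a := fun e => by
      simpa using (Path.mem_of_same_content (w := []) (by subst e; exact h2))
    simp only [List.mem_cons, List.not_mem_nil, or_false] at h1 h1'
    exact switch_letter_triple_right h (by omega) (by omega) (by omega)

theorem exists_switch_letter (u : List ℤ) (x : ℤ) : ∃ y u', switch u [x] = ([y], u') := by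
  have h := length_switch_fst u [x]
  obtain ⟨y, hy⟩ := List.length_eq_one_iff.1 h
  exact ⟨y, _, Prod.ext hy rfl⟩

theorem exists_letter_switch (x : ℤ) (t : List ℤ) : ∃ t' y, switch [x] t = (t', [y]) :=
  ⟨_, _, rfl⟩

theorem KnuthStep.switch_letter (h : KnuthStep u u') (hp : Path μ (u ++ [x]) ν) :
    (switch u [x]).1 = (switch u' [x]).1 ∧ KnuthStep (switch u [x]).2 (switch u' [x]).2 := by
  obtain ⟨p, l, l', q, h, rfl, rfl⟩ := h
  obtain ⟨y, q', hq⟩ := exists_switch_letter q x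
  simp only [List.append_assoc] at hp
  obtain ⟨κ, -, h2⟩ := Path.append_iff.1 hp
  obtain ⟨κ', h3, h4⟩ := Path.append_iff.1 h2
  have h5 := h4.switch
  rw [hq] at h5
  obtain ⟨κ'', h6, -⟩ := Path.append_iff.1 h5
  obtain ⟨e1, e2⟩ := h.switch_letter (h3.append h6)
  simp only [switch_append_left, hq, e1, true_and]
  exact ⟨_, _, _, _, e2, rfl, rfl⟩

theorem KnuthStep.letter_switch (h : KnuthStep t t') (hp : Path μ (x :: t) ν) :
    (switch [x] t).2 = (switch [x] t').2 ∧ KnuthStep (switch [x] t).1 (switch [x] t').1 := by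
  obtain ⟨p, l, l', q, h, rfl, rfl⟩ := h
  obtain ⟨p', y, hq⟩ := exists_letter_switch x p
  have h1 : Path μ ([x] ++ p ++ l ++ q) ν := by simpa using hp
  obtain ⟨κ, h2, -⟩ := Path.append_iff.1 h1
  obtain ⟨κ', h3, h4⟩ := Path.append_iff.1 h2
  have h5 := h3.switch
  rw [hq] at h5
  obtain ⟨κ'', -, h6⟩ := Path.append_iff.1 h5
  obtain ⟨e1, e2⟩ := h.letter_switch (show Path κ'' (y :: l) κ from h6.append h4)
  simp only [switch_append_right, hq, e1, true_and]
  exact ⟨_, _, _, _, e2, rfl, rfl⟩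

theorem KnuthEquiv.switch_letter (h : KnuthEquiv u u') (hp : Path μ (u ++ [x]) ν) :
    (switch u [x]).1 = (switch u' [x]).1 ∧ KnuthEquiv (switch u [x]).2 (switch u' [x]).2 := by
  induction h with
  | refl => exact ⟨rfl, .refl _⟩
  | @tail v v' hv hs ih =>
    obtain ⟨κ, h1, h2⟩ := Path.append_iff.1 hp
    obtain ⟨e1, e2⟩ := hs.switch_letter ((KnuthEquiv.path hv h1).append h2)
    exact ⟨ih.1.trans e1, Relation.ReflTransGen.tail ih.2 e2⟩

theorem KnuthEquiv.letter_switch (h : KnuthEquiv t t') (hp : Path μ (x :: t) ν) :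
    (switch [x] t).2 = (switch [x] t').2 ∧ KnuthEquiv (switch [x] t).1 (switch [x] t').1 := by
  induction h with
  | refl => exact ⟨rfl, .refl _⟩
  | @tail v v' hv hs ih =>
    obtain ⟨κ, h1, h2⟩ := hp
    obtain ⟨e1, e2⟩ := hs.letter_switch ⟨κ, h1, (KnuthEquiv.path hv h2)⟩
    exact ⟨ih.1.trans e1, Relation.ReflTransGen.tail ih.2 e2⟩

theorem KnuthEquiv.switch_left (h : KnuthEquiv u u') (hp : Path μ (u ++ t) ν) :
    (switch u t).1 = (switch u' t).1 ∧ KnuthEquiv (switch u t).2 (switch u' t).2 := by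
  induction t generalizing u u' μ with
  | nil => simpa using h
  | cons x t ih =>
    obtain ⟨κ, h1, h2⟩ := Path.append_iff.1 (show Path μ ((u ++ [x]) ++ t) ν by simpa using hp)
    obtain ⟨e1, e2⟩ := h.switch_letter h1
    obtain ⟨κ', -, h4⟩ := Path.append_iff.1 h1.switch
    obtain ⟨e3, e4⟩ := ih e2 (h4.append h2)
    rw [show x :: t = [x] ++ t from rfl, switch_append_right, switch_append_right]
    exact ⟨by rw [e1, e3], e4⟩

theorem KnuthEquiv.switch_right (h : KnuthEquiv t t') (hp : Path μ (u ++ t) ν) :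
    (switch u t).2 = (switch u t').2 ∧ KnuthEquiv (switch u t).1 (switch u t').1 := by
  induction u generalizing μ with
  | nil => simpa using h
  | cons x u ih =>
    obtain ⟨κ, h1, h2⟩ := hp
    obtain ⟨e1, e2⟩ := ih h2
    obtain ⟨κ', h3, -⟩ := Path.append_iff.1 h2.switch
    obtain ⟨e3, e4⟩ := e2.letter_switch (x := x) ⟨κ, h1, h3⟩
    rw [show x :: u = [x] ++ u from rfl, switch_append_left, switch_append_left]
    exact ⟨by rw [e1, e3], e4⟩

/-- All standard tableaux of a given straight shape are dual equivalent. -/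
theorem KnuthEquiv.of_path_bot (h : Path ⊥ w μ) (h' : Path ⊥ w' μ) : KnuthEquiv w w' := by
  -- words ending in the same letter are handled by induction; otherwise pass through words that end
  -- in `r, q, p` and `r, p, q`, where `r` is the content of a corner between those of `p` and `q`
  induction hn : w.length generalizing w w' μ with
  | zero =>
    have hc := h.card
    have hc' := h'.card
    rw [List.length_eq_zero_iff.1 hn, List.length_eq_zero_iff.1 (show w'.length = 0 by omega)]
    exact .refl _
  | succ n ih =>
    have hc := h.card
    have hc' := h'.card
    have hw : w ≠ [] := by rintro rfl; simp at hn
    have hw' : w' ≠ [] := by rintro rfl; simp at hc'; omega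
    obtain ⟨v, p, rfl⟩ : ∃ v p, w = v ++ [p] := ⟨_, _, (List.dropLast_append_getLast hw).symm⟩
    obtain ⟨v', q, rfl⟩ : ∃ v p, w' = v ++ [p] := ⟨_, _, (List.dropLast_append_getLast hw').symm⟩
    obtain ⟨κ, h1, h2⟩ := Path.append_iff.1 h
    obtain ⟨κ', h1', h2'⟩ := Path.append_iff.1 h'
    rw [Path.singleton_iff] at h2 h2'
    simp only [List.length_append, List.length_singleton] at hn hc hc'
    by_cases hpq : p = q
    · subst hpq
      obtain rfl := h2.unique_left h2'
      exact (ih h1 h1' (by omega)).append (.refl _)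
    · obtain ⟨δ, h3, h3'⟩ := h2.exists_inter h2' hpq
      obtain ⟨r, ρ, hρ, hr⟩ : ∃ r ρ, AddBox ρ r δ ∧ (p < r ∧ r < q ∨ q < r ∧ r < p) := by
        rcases lt_or_gt_of_ne hpq with hlt | hlt
        · obtain ⟨r, ρ, h4, h5⟩ := exists_corner_between h3' h3 hlt
          exact ⟨r, ρ, h4, Or.inl h5⟩
        · obtain ⟨r, ρ, h4, h5⟩ := exists_corner_between h3 h3' hlt
          exact ⟨r, ρ, h4, Or.inr h5⟩
      obtain ⟨s, hs⟩ := Path.exists_of_le (bot_le (a := ρ))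
      have h6 : Path ⊥ (s ++ [r, q]) κ := hs.append ⟨δ, hρ, Path.singleton_iff.2 h3⟩
      have h6' : Path ⊥ (s ++ [r, p]) κ' := hs.append ⟨δ, hρ, Path.singleton_iff.2 h3'⟩
      have e1 := (ih h1 h6 (by omega)).append (.refl [p])
      have e2 := (ih h1' h6' (by omega)).append (.refl [q])
      have e3 : KnuthEquiv (s ++ [r, q] ++ [p]) (s ++ [r, p] ++ [q]) := by
        simp only [List.append_assoc]
        exact (KnuthEquiv.refl s).append (KnuthTriple.right hr.symm).equiv
      exact (e1.trans e3).trans e2.symm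

end Dual

/-! ### Complements in a rectangle -/

section Complement

variable {m n : ℕ} {γ μ ν α δ β κ ρ : YoungDiagram} {x y z c : ℤ} {w w' : List ℤ}

theorem mem_rectangle {i j : ℕ} : (i, j) ∈ rectangle m n ↔ i < m ∧ j < n := by
  rw [← YoungDiagram.mem_cells]
  simp [rectangle]

/-- The complement of a shape in the `m × n` rectangle, rotated by a half turn. Only the part of
the shape inside the rectangle matters. -/
def complement (m n : ℕ) (μ : YoungDiagram) : YoungDiagram where
  cells := (rectangle m n).cells.filter fun d => (m - 1 - d.1, n - 1 - d.2) ∉ μ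
  isLowerSet := by
    rintro ⟨a, b⟩ ⟨c, d⟩ ⟨hca, hdb⟩ h
    simp only at hca hdb
    simp only [Finset.coe_filter, YoungDiagram.mem_cells, Set.mem_ofPred_eq, mem_rectangle] at h ⊢
    exact ⟨by omega, fun e => h.2 (μ.up_left_mem (by omega) (by omega) e)⟩

theorem mem_complement {i j : ℕ} :
    (i, j) ∈ complement m n μ ↔ i < m ∧ j < n ∧ (m - 1 - i, n - 1 - j) ∉ μ := by
  rw [← YoungDiagram.mem_cells]
  simp [complement, mem_rectangle, and_assoc]

theorem complement_le : complement m n μ ≤ rectangle m n := by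
  rintro ⟨i, j⟩ h
  rw [mem_complement] at h
  exact mem_rectangle.2 ⟨h.1, h.2.1⟩

theorem complement_complement (h : μ ≤ rectangle m n) : complement m n (complement m n μ) = μ := by
  refine SetLike.ext ?_
  rintro ⟨i, j⟩
  simp only [mem_complement]
  constructor
  · rintro ⟨hi, hj, h1⟩
    by_contra h2
    refine h1 ⟨by omega, by omega, ?_⟩
    rwa [show m - 1 - (m - 1 - i) = i by omega, show n - 1 - (n - 1 - j) = j by omega]
  · intro h1
    obtain ⟨hi, hj⟩ := mem_rectangle.1 (h h1)
    refine ⟨hi, hj, fun h2 => h2.2.2 ?_⟩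
    rwa [show m - 1 - (m - 1 - i) = i by omega, show n - 1 - (n - 1 - j) = j by omega]

theorem complement_bot : complement m n ⊥ = rectangle m n := by
  refine SetLike.ext ?_
  rintro ⟨i, j⟩
  simp [mem_complement, mem_rectangle]

theorem complement_rectangle : complement m n (rectangle m n) = ⊥ := by
  rw [← complement_bot, complement_complement bot_le]

theorem AddBox.complement (h : AddBox μ x ν) (hν : ν ≤ rectangle m n) :
    AddBox (complement m n ν) ((n : ℤ) - m - x) (complement m n μ) := by
  obtain ⟨i, j, hx, h0, h1⟩ := h
  obtain ⟨hi, hj⟩ := mem_rectangle.1 (hν ((h1 (i, j)).2 (Or.inl rfl)))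
  refine ⟨m - 1 - i, n - 1 - j, by omega, ?_, ?_⟩
  · rw [mem_complement, show m - 1 - (m - 1 - i) = i by omega,
      show n - 1 - (n - 1 - j) = j by omega]
    exact fun h => h.2.2 ((h1 _).2 (Or.inl rfl))
  · rintro ⟨a, b⟩
    simp only [mem_complement, h1, Prod.mk.injEq]
    constructor
    · rintro ⟨ha, hb, h2⟩
      by_cases hab : m - 1 - a = i ∧ n - 1 - b = j
      · left; omega
      · right
        exact ⟨ha, hb, fun e => e.elim hab h2⟩
    · rintro (⟨rfl, rfl⟩ | ⟨ha, hb, h2⟩)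
      · refine ⟨by omega, by omega, ?_⟩
        rwa [show m - 1 - (m - 1 - i) = i by omega, show n - 1 - (n - 1 - j) = j by omega]
      · exact ⟨ha, hb, fun e => h2 (Or.inr e)⟩

/-- The content word of the complementary chain, when `c` is the content of the last box of the
rectangle. -/
def reflect (c : ℤ) (w : List ℤ) : List ℤ := w.reverse.map (c - ·)

theorem reflect_append (c : ℤ) (u v : List ℤ) :
    reflect c (u ++ v) = reflect c v ++ reflect c u := by
  simp [reflect]

theorem reflect_reflect (c : ℤ) (w : List ℤ) : reflect c (reflect c w) = w := by
  simp [reflect, ← List.map_reverse]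

theorem KnuthEquiv.reflect (h : KnuthEquiv w w') (c : ℤ) :
    KnuthEquiv (reflect c w) (reflect c w') := by
  refine Relation.ReflTransGen.lift (p := KnuthStep) (LayeredTableaux.reflect c) ?_ _ _ h
  rintro _ _ ⟨p, l, l', q, h, rfl, rfl⟩
  refine ⟨_, LayeredTableaux.reflect c l, LayeredTableaux.reflect c l', _, ?_, by
    simp only [reflect_append, List.append_assoc]; rfl, by
    simp only [reflect_append, List.append_assoc]⟩
  cases h with
  | left h => exact .right (by beta_reduce; omega)
  | right h => exact .left (by beta_reduce; omega)

theorem Path.complement (h : Path μ w ν) (hν : ν ≤ rectangle m n) :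
    Path (complement m n ν) (reflect ((n : ℤ) - m) w) (complement m n μ) := by
  induction w generalizing μ with
  | nil => rw [Path.nil_iff.1 h]; rfl
  | cons x w ih =>
    obtain ⟨κ, h1, h2⟩ := h
    rw [show x :: w = [x] ++ w from rfl, reflect_append]
    exact (ih h2).append (Path.singleton_iff.2 (h1.complement (h2.le.trans hν)))

/-- All standard tableaux of shape `Λ / μ`, for a rectangle `Λ`, are dual equivalent. -/
theorem KnuthEquiv.of_path_rectangle (h : Path μ w (rectangle m n))
    (h' : Path μ w' (rectangle m n)) : KnuthEquiv w w' := by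
  have h1 := h.complement le_rfl
  have h1' := h'.complement le_rfl
  rw [complement_rectangle] at h1 h1'
  have := (KnuthEquiv.of_path_bot h1 h1').reflect ((n : ℤ) - m)
  rwa [reflect_reflect, reflect_reflect] at this

end Complement

/-! ### Rectification -/

section Rectification

variable {μ ν κ : YoungDiagram} {u t p p' r s b b' : List ℤ}

/-- The rectification does not depend on the tableau that fills the inner shape: tableaux of one
straight shape are dual equivalent. -/
theorem switch_fst_eq_of_path_bot (hp : Path ⊥ p μ) (hp' : Path ⊥ p' μ) (ht : Path μ t ν) :
    (switch p t).1 = (switch p' t).1 :=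
  ((KnuthEquiv.of_path_bot hp hp').switch_left (hp.append ht)).1

/-- The word `r` is the rectification of the word `t` with inner shape `μ`: it is the first
component of switching `t` with the content word of any tableau of shape `μ`. -/
def Rectifies (μ : YoungDiagram) (t r : List ℤ) : Prop :=
  ∀ p, Path ⊥ p μ → (switch p t).1 = r

theorem exists_rectifies (ht : Path μ t ν) : ∃ r, Rectifies μ t r := by
  obtain ⟨p, hp⟩ := Path.exists_of_le (bot_le (a := μ))
  exact ⟨_, fun p' hp' => switch_fst_eq_of_path_bot hp' hp ht⟩

/-- Switching preserves rectifications. For the second component this follows by reading the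
switching backwards. -/
theorem Rectifies.switch (hu : Path μ u κ) (ht : Path κ t ν) (hru : Rectifies μ u r)
    (hrt : Rectifies κ t s) : ∃ κ', Path μ (switch u t).1 κ' ∧ Path κ' (switch u t).2 ν ∧
      Rectifies μ (switch u t).1 s ∧ Rectifies κ' (switch u t).2 r := by
  obtain ⟨κ', h1, h2⟩ := Path.append_iff.1 (hu.append ht).switch
  refine ⟨κ', h1, h2, fun p hp => ?_, fun q hq => ?_⟩
  · rw [← hrt (p ++ u) (hp.append hu), switch_append_left]
  · obtain ⟨p, hp⟩ := Path.exists_of_le (bot_le (a := μ))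
    rw [switch_fst_eq_of_path_bot hq (hp.append h1) h2, switch_append_left, switch_switch]
    exact hru p hp

/-- Switching `b` with a filling `p` of the inner shape gives the rectification of `b` and a second
component that depends only on the Knuth class of `b`; switching back recovers `b`. -/
theorem Rectifies.eq_of_knuthEquiv (hb : Path μ b ν) (h : KnuthEquiv b b')
    (hr : Rectifies μ b r) (hr' : Rectifies μ b' r) : b = b' := by
  obtain ⟨p, hp⟩ := Path.exists_of_le (bot_le (a := μ))
  have h1 : LayeredTableaux.switch p b = LayeredTableaux.switch p b' :=
    Prod.ext ((hr p hp).trans (hr' p hp).symm) (h.switch_right (hp.append hb)).1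
  have h2 := switch_switch p b
  rw [h1, switch_switch] at h2
  exact (congrArg Prod.snd h2).symm

end Rectification

/-! ### The shape of a rectification in the rectangle -/

section Rectangle

variable {m n : ℕ} {γ μ ν α α₀ α₁ α₂ α' δ β κ ρ ρ₀ ρ' : YoungDiagram} {x y z c v : ℤ}
  {a t w w' s : List ℤ}

theorem AddBox.content_unique (h : AddBox μ x ν) (h' : AddBox μ y ν) : x = y := by
  obtain ⟨i, j, rfl, h0, h1⟩ := h
  obtain ⟨i', j', rfl, h0', h1'⟩ := h'
  have := ((h1' _).1 ((h1 (i, j)).2 (Or.inl rfl))).resolve_right h0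
  simp only [Prod.mk.injEq] at this
  omega

/-- A shape in the middle of a two-step chain from `α₀` to `α₂` is the given one, or adds first the
box which the given chain adds second. -/
theorem AddBox.eq_or_content_eq (h1 : AddBox α₀ z α₁) (h2 : AddBox α₁ x α₂) (h : AddBox α₀ c α')
    (hle : α' ≤ α₂) : α' = α₁ ∨ c = x := by
  obtain ⟨i, j, hz, h0, h1⟩ := h1
  obtain ⟨i', j', hx, h0', h2⟩ := h2
  obtain ⟨k, l, hc, h0'', h3⟩ := h
  rcases (h2 _).1 (hle ((h3 (k, l)).2 (Or.inl rfl))) with e | e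
  · simp only [Prod.mk.injEq] at e
    right; omega
  · have e' := ((h1 _).1 e).resolve_right h0''
    left
    exact SetLike.ext fun d => by rw [h1, h3, e']

theorem AddBox.eq_zero_of_bot (h : AddBox ⊥ x ν) : x = 0 := by
  obtain ⟨i, j, rfl, h0, h1⟩ := h
  have := (h1 _).1 (ν.up_left_mem (Nat.zero_le i) (Nat.zero_le j) ((h1 (i, j)).2 (Or.inl rfl)))
  simp only [Prod.mk.injEq, YoungDiagram.notMem_bot, or_false] at this
  omega

theorem Path.ne (h : Path μ [x, y] ν) : x ≠ y := by
  rintro rfl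
  simpa using Path.mem_of_same_content (w := []) h

/-- The two boxes of a straight shape with two boxes have adjacent contents. -/
theorem Path.localSwap_of_bot (h : Path ⊥ [x, y] ν) :
    LayeredTableaux.localSwap x y = (x, y) := by
  unfold LayeredTableaux.localSwap
  split_ifs with hadj
  · rfl
  · obtain ⟨κ, h1, h2⟩ := id h
    obtain ⟨δ, h3, -⟩ := h1.swap (Path.singleton_iff.1 h2) (by omega) (by omega)
    exact absurd (h1.eq_zero_of_bot.trans h3.eq_zero_of_bot.symm) h.ne

theorem switch_pair_lt (h : Path μ (a ++ [z, x]) ν) :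
    ∃ p q a', switch a [z, x] = ([p, q], a') ∧ (p < q ↔ z < x) := by
  induction a generalizing μ with
  | nil => exact ⟨z, x, [], rfl, Iff.rfl⟩
  | cons y a ih =>
    obtain ⟨κ, h1, h2⟩ := h
    obtain ⟨p, q, a', h3, h4⟩ := ih h2
    have h5 := h2.switch
    rw [h3] at h5
    obtain ⟨κ', h6, -⟩ := Path.append_iff.1 h5
    have h7 : Path μ ([y, p] ++ [q]) κ' := ⟨κ, h1, h6⟩
    have e1 : y ≠ q := by
      rintro rfl
      have := Path.mem_of_same_content (w := [p]) (show Path μ (y :: ([p] ++ [y])) κ' from h7)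
      simp only [List.mem_singleton] at this
      omega
    obtain ⟨κ'', h8, -⟩ := Path.append_iff.1 h7
    obtain ⟨p', q', y', h9, h10⟩ := switch_letter_pair_lt h6.ne h8.ne e1
    refine ⟨p', q', y' :: a', ?_, h10.trans h4⟩
    rw [show y :: a = [y] ++ a from rfl, switch_append_left, h3, h9]
    rfl

theorem pair_switch_lt {p q : ℤ} (h : Path μ ([p, q] ++ s) ν) :
    ∃ s' p' q', switch [p, q] s = (s', [p', q']) ∧ (p' < q' ↔ p < q) := by
  induction s generalizing μ p q with
  | nil => exact ⟨[], p, q, rfl, Iff.rfl⟩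
  | cons y s ih =>
    obtain ⟨κ, h1, h2⟩ := Path.append_iff.1 (show Path μ ([p, q, y] ++ s) ν from h)
    obtain ⟨κ', h3, -⟩ := Path.append_iff.1 (show Path μ ([p, q] ++ [y]) κ from h1)
    have e1 : p ≠ y := by
      rintro rfl
      have := Path.mem_of_same_content (w := [q]) (show Path μ (p :: ([q] ++ [p])) κ from h1)
      simp only [List.mem_singleton] at this
      omega
    obtain ⟨κ'', h4, h5⟩ := id h1
    obtain ⟨p', q', y', h6, h7⟩ := switch_pair_letter_lt h3.ne h5.ne e1
    have h8 := (show Path μ ([p, q] ++ [y]) κ from h1).switch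
    rw [h6] at h8
    obtain ⟨κ₃, -, h9⟩ := Path.append_iff.1 h8
    obtain ⟨s', p₂, q₂, h10, h11⟩ := ih (h9.append h2)
    refine ⟨y' :: s', p₂, q₂, ?_, h11.trans h7⟩
    rw [show y :: s = [y] ++ s from rfl, switch_append_right, h6, h10]
    rfl

/-- Some tableau of shape `Λ / α`, where `Λ` is the `m × n` rectangle, rectifies to a tableau of
shape `ρ`. -/
def IsDualShape (m n : ℕ) (α ρ : YoungDiagram) : Prop :=
  ∃ a t, Path ⊥ a α ∧ Path α t (rectangle m n) ∧ Path ⊥ (switch a t).1 ρ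

namespace IsDualShape

/-- The shape of the rectification does not depend on the choice of the tableaux. -/
theorem path (h : IsDualShape m n α ρ) (ha : Path ⊥ a α) (ht : Path α t (rectangle m n)) :
    Path ⊥ (switch a t).1 ρ := by
  obtain ⟨a₀, t₀, ha₀, ht₀, h⟩ := h
  have e1 := ((KnuthEquiv.of_path_bot ha ha₀).switch_left (ha.append ht)).1
  have e2 := ((KnuthEquiv.of_path_rectangle ht₀ ht).switch_right (ha₀.append ht₀)).2
  rw [e1]
  exact e2.path h

theorem unique (h : IsDualShape m n α ρ) (h' : IsDualShape m n α ρ') : ρ = ρ' := by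
  obtain ⟨a, t, ha, ht, h⟩ := h
  exact h.unique (h'.path ha ht)

theorem symm (h : IsDualShape m n α ρ) : IsDualShape m n ρ α := by
  obtain ⟨a, t, ha, ht, h⟩ := h
  obtain ⟨κ, h1, h2⟩ := Path.append_iff.1 (ha.append ht).switch
  obtain rfl := h1.unique h
  refine ⟨_, _, h1, h2, ?_⟩
  rwa [switch_switch]

theorem exists_of_le (hα : α ≤ rectangle m n) : ∃ ρ, IsDualShape m n α ρ := by
  obtain ⟨a, ha⟩ := Path.exists_of_le (bot_le (a := α))
  obtain ⟨t, ht⟩ := Path.exists_of_le hα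
  obtain ⟨ρ, h, -⟩ := Path.append_iff.1 (ha.append ht).switch
  exact ⟨ρ, a, t, ha, ht, h⟩

theorem le (h : IsDualShape m n α ρ) : α ≤ rectangle m n := by
  obtain ⟨a, t, ha, ht, h⟩ := h
  exact ht.le

theorem bot (h : IsDualShape m n ⊥ ρ) : ρ = rectangle m n := by
  obtain ⟨t, ht⟩ := Path.exists_of_le (bot_le (a := rectangle m n))
  exact (h.path (a := []) rfl ht).unique ht

/-- Adding a box to `α` removes a box from the dual shape. -/
theorem of_addBox (h : AddBox α₀ z α₁) (hα : α₁ ≤ rectangle m n) (h₀ : IsDualShape m n α₀ ρ₀) :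
    ∃ ρ₁ v, AddBox ρ₁ v ρ₀ ∧ IsDualShape m n α₁ ρ₁ := by
  obtain ⟨a, ha⟩ := Path.exists_of_le (bot_le (a := α₀))
  obtain ⟨t, ht⟩ := Path.exists_of_le hα
  obtain ⟨p, a', e1⟩ := exists_switch_letter a z
  have haz : Path ⊥ (a ++ [z]) α₁ := ha.append (Path.singleton_iff.2 h)
  have hpa := haz.switch
  rw [e1] at hpa
  have h1 := h₀.path ha (t := z :: t) ⟨α₁, h, ht⟩
  rw [show z :: t = [z] ++ t from rfl, switch_append_right, e1] at h1
  have h2 := h1.switch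
  obtain ⟨ρ₁, h3, h4⟩ := Path.append_iff.1 h2
  rw [switch_singleton_left, Path.singleton_iff] at h4
  refine ⟨ρ₁, _, h4, a ++ [z], t, haz, ht, ?_⟩
  rw [switch_fst_eq_of_path_bot haz hpa ht, switch_append_left]
  exact h3

/-- The contents of the boxes removed from the dual shape when two boxes are added to `α` are in
the same relative order as those of the added boxes, because switching preserves descents. -/
theorem of_addBox_addBox (h : AddBox α₀ z α₁) (h' : AddBox α₁ x α₂) (hα : α₂ ≤ rectangle m n)
    (h₀ : IsDualShape m n α₀ ρ₀) :
    ∃ ρ₁ ρ₂ v₁ v₂, AddBox ρ₁ v₁ ρ₀ ∧ AddBox ρ₂ v₂ ρ₁ ∧ IsDualShape m n α₁ ρ₁ ∧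
      IsDualShape m n α₂ ρ₂ ∧ (v₂ < v₁ ↔ z < x) := by
  obtain ⟨a, ha⟩ := Path.exists_of_le (bot_le (a := α₀))
  obtain ⟨t, ht⟩ := Path.exists_of_le hα
  have haz : Path ⊥ (a ++ [z]) α₁ := ha.append (Path.singleton_iff.2 h)
  have hazx : Path ⊥ (a ++ [z, x]) α₂ := ha.append ⟨α₁, h, Path.singleton_iff.2 h'⟩
  obtain ⟨p, q, a', e1, hlt⟩ := switch_pair_lt hazx
  obtain ⟨p', a₁, e2⟩ := exists_switch_letter a z
  obtain ⟨q', a₂, e3⟩ := exists_switch_letter a₁ x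
  have e4 := switch_append_right a [z] [x]
  rw [e2] at e4
  simp only [e3, List.singleton_append, e1, Prod.mk.injEq, List.cons.injEq, and_true] at e4
  obtain ⟨⟨rfl, rfl⟩, rfl⟩ := e4
  have hpa := haz.switch
  rw [e2] at hpa
  have hpqa := hazx.switch
  rw [e1] at hpqa
  have h1 := h₀.path ha (t := [z, x] ++ t) ⟨α₁, h, α₂, h', ht⟩
  rw [switch_append_right, e1] at h1
  obtain ⟨s, v₂, v₁, e5, hlt'⟩ := pair_switch_lt h1
  have hsw : localSwap p q = (p, q) := by
    obtain ⟨_, h2, -⟩ := Path.append_iff.1 h1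
    exact h2.localSwap_of_bot
  -- split the switching of `[p, q]` past the remaining word into those of `q` and of `p`
  have e6 := switch_append_left [p] [q] (switch a' t).1
  simp only [List.singleton_append, e5] at e6
  obtain ⟨s₁, v, e7⟩ := exists_letter_switch q (switch a' t).1
  obtain ⟨s₂, v', e8⟩ := exists_letter_switch p s₁
  simp only [e7, e8, Prod.mk.injEq, List.singleton_append, List.cons.injEq, and_true] at e6
  obtain ⟨rfl, rfl, rfl⟩ := e6
  have h2 := h1.switch
  rw [e5] at h2
  obtain ⟨ρ₂, h3, ρ₁, h4, h5⟩ := Path.append_iff.1 h2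
  rw [Path.singleton_iff] at h5
  refine ⟨ρ₁, ρ₂, v₁, v₂, h5, h4, ⟨a ++ [z], [x] ++ t, haz, ⟨α₂, h', ht⟩, ?_⟩,
    ⟨a ++ [z, x], t, hazx, ht, ?_⟩, hlt'.trans hlt⟩
  · rw [switch_fst_eq_of_path_bot haz hpa (show Path α₁ ([x] ++ t) _ from ⟨α₂, h', ht⟩),
      switch_append_left, switch_append_right a₁, e3]
    have e9 : switch [p] [q] = ([p], [q]) := by
      simp [switch, LayeredTableaux.pass, hsw]
    rw [switch_append_right, e9]
    simp only [e7]
    have h6 : Path ⊥ (s ++ [v₂]) ρ₁ := h3.append (Path.singleton_iff.2 h4)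
    have h7 := h6.switch
    have h8 := switch_switch [p] s₁
    rw [e8] at h8
    rwa [h8] at h7
  · rw [switch_fst_eq_of_path_bot hazx hpqa ht, switch_append_left, e5]
    exact h3

/-- A tableau of shape `Λ / α` rectifies to the complement of `α`. By induction along a chain of
shapes that ends with the boxes of contents `z` and `x`: if the two boxes can be added in either
order, the claim for the shapes in the middle determines the content removed last. Otherwise
that content is adjacent to the one removed before, and their order is known. -/
theorem eq_complement (h : IsDualShape m n α ρ) : ρ = complement m n α := by
  induction hn : α.card using Nat.strong_induction_on generalizing α ρ with
  | _ k ih =>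
  obtain ⟨w, hw⟩ := Path.exists_of_le (bot_le (a := α))
  rcases List.eq_nil_or_concat w with rfl | ⟨w₁, x, rfl⟩
  · obtain rfl := Path.nil_iff.1 hw
    rw [complement_bot, h.bot]
  rw [List.concat_eq_append] at hw
  obtain ⟨α₁, hw₁, hx⟩ := Path.append_iff.1 hw
  rw [Path.singleton_iff] at hx
  have hle := h.le
  have hcx := hx.complement hle
  have hc₁ := hx.card
  rcases List.eq_nil_or_concat w₁ with rfl | ⟨w₀, z, rfl⟩
  · obtain rfl := Path.nil_iff.1 hw₁
    obtain ⟨ρ₀, h₀⟩ := IsDualShape.exists_of_le (bot_le (a := rectangle m n))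
    obtain ⟨ρ₁, v, h1, h2⟩ := h₀.of_addBox hx hle
    obtain rfl := h2.unique h
    obtain rfl := h₀.bot
    have h3 := (h1.complement le_rfl)
    have h4 := (hcx.complement complement_le)
    rw [complement_bot, complement_rectangle] at h4
    rw [complement_rectangle] at h3
    have e1 := h3.eq_zero_of_bot
    have e2 := h4.eq_zero_of_bot
    rw [complement_bot] at hcx
    have e3 : v = (n : ℤ) - m - x := by omega
    subst e3
    exact h1.unique_left hcx
  rw [List.concat_eq_append] at hw₁
  obtain ⟨α₀, hw₀, hz⟩ := Path.append_iff.1 hw₁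
  rw [Path.singleton_iff] at hz
  have hc₀ := hz.card
  have hle₁ := hx.le.trans hle
  obtain ⟨ρ₀, h₀⟩ := IsDualShape.exists_of_le (hz.le.trans hle₁)
  obtain ⟨ρ₁, ρ₂, v₁, v₂, hv₁, hv₂, h₁, h₂, hlt⟩ := h₀.of_addBox_addBox hz hx hle
  obtain rfl := h₂.unique h
  have e₀ := ih _ (by omega) h₀ rfl
  have e₁ := ih _ (by omega) h₁ rfl
  have hcz := hz.complement hle₁
  rw [← e₀, ← e₁] at hcz
  have ev₁ := hv₁.content_unique hcz
  have hzx : z ≠ x :=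
    Path.ne (show Path α₀ [z, x] α from ⟨α₁, hz, Path.singleton_iff.2 hx⟩)
  have hvv : v₂ ≠ v₁ :=
    Path.ne (show Path ρ₂ [v₂, v₁] ρ₀ from ⟨ρ₁, hv₂, Path.singleton_iff.2 hv₁⟩)
  suffices hv : v₂ = (n : ℤ) - m - x by
    rw [← e₁, ← hv] at hcx
    exact hv₂.unique_left hcx
  by_cases hadj : z = x + 1 ∨ x = z + 1
  · by_cases hadj' : v₂ = v₁ + 1 ∨ v₁ = v₂ + 1
    · omega
    · -- two middle shapes on the dual side would give two middle shapes between `α₀` and `α`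
      exfalso
      obtain ⟨ρ₁', h1, h2⟩ := hv₂.swap hv₁ (by omega) (by omega)
      have hρ₀ := h₀.symm.le
      obtain ⟨α₁', c', h3, h4⟩ := h₂.symm.of_addBox h1 (h2.le.trans hρ₀)
      obtain ⟨α₀', c, h5, h6⟩ := h4.of_addBox h2 hρ₀
      obtain rfl := h6.unique h₀.symm
      rcases hz.eq_or_content_eq hx h5 h3.le with rfl | rfl
      · obtain rfl := h4.symm.unique h₁
        exact hvv (h2.content_unique hv₁)
      · rcases hadj with e | e
        · exact h5.not_adjacent hz e
        · exact hz.not_adjacent h5 e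
  · obtain ⟨α₁', h1, h2⟩ := hz.swap hx (by omega) (by omega)
    have hc' := h2.card
    obtain ⟨ρ₁', v', h3, h4⟩ := h₀.of_addBox h1 (h2.le.trans hle)
    obtain ⟨ρ₂', v'', h5, h6⟩ := h4.of_addBox h2 hle
    obtain rfl := h6.unique h₂
    have e₁' := ih _ (by omega) h4 rfl
    have hc1 := h1.complement (h2.le.trans hle)
    rw [← e₀, ← e₁'] at hc1
    have ev' := h3.content_unique hc1
    rcases h5.eq_or_content_eq h3 hv₂ hv₁.le with rfl | e
    · have := hv₁.content_unique h3
      omega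
    · omega

end IsDualShape

theorem Path.switch_rectangle (ha : Path ⊥ a α) (ht : Path α t (rectangle m n)) :
    Path ⊥ (LayeredTableaux.switch a t).1 (LayeredTableaux.complement m n α) := by
  obtain ⟨ρ, h⟩ := IsDualShape.exists_of_le ht.le
  rw [← h.eq_complement]
  exact h.path ha ht

end Rectangle

/-! ### Promotion and rotation of the layers -/

section Promotion

variable {m n : ℕ} {μ ν α : YoungDiagram} {a b c t w w' : List ℤ}

/-- Promotion: the first letter is moved through the whole word to its end. -/
def promote : List ℤ → List ℤ
  | [] => []
  | x :: w => (pass x w).1 ++ [(pass x w).2]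

theorem Path.promote (h : Path μ w ν) : Path μ (promote w) ν := by
  cases w with
  | nil => exact h
  | cons x w => exact h.pass

theorem Path.promote_iterate (h : Path μ w ν) (k : ℕ) :
    Path μ (LayeredTableaux.promote^[k] w) ν := by
  induction k generalizing w with
  | zero => exact h
  | succ k ih => exact ih h.promote

/-- Promoting once for each letter of `a` moves `t` to the front in the same way as switching with
`a`. The letters of `a` come out differently, but up to dual equivalence that does not matter. -/
theorem exists_promote_iterate (h : Path ⊥ (a ++ t) ν) :
    ∃ r, promote^[a.length] (a ++ t) = (switch a t).1 ++ r := by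
  induction hn : a.length generalizing a t with
  | zero =>
    obtain rfl := List.length_eq_zero_iff.1 hn
    exact ⟨[], by simp⟩
  | succ k ih =>
    obtain ⟨x, a, rfl⟩ := List.exists_cons_of_length_eq_add_one hn
    obtain ⟨a₁, y, e1⟩ : ∃ a₁ y, pass x a = (a₁, y) := ⟨_, _, rfl⟩
    obtain ⟨t₁, x', e2⟩ : ∃ t₁ x', pass y t = (t₁, x') := ⟨_, _, rfl⟩
    have e3 : promote (x :: a ++ t) = a₁ ++ (t₁ ++ [x']) := by
      simp [promote, pass_append, e1, e2]
    have h1 : Path ⊥ (a₁ ++ (t₁ ++ [x'])) ν := e3 ▸ h.promote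
    have hlen : a₁.length = k := by
      have := length_pass x a
      rw [e1] at this
      simp only [List.length_cons] at hn
      simp only at this
      omega
    obtain ⟨r, hr⟩ := ih h1 hlen
    obtain ⟨κ, h2, h3⟩ := Path.append_iff.1 h
    have h4 : Path ⊥ (a₁ ++ [y]) κ := by simpa [e1] using h2.pass
    rw [Function.iterate_succ_apply, e3, hr, switch_append_right,
      switch_fst_eq_of_path_bot h2 h4 h3, switch_append_left, switch_singleton_left, e2,
      List.append_assoc]
    exact ⟨_, rfl⟩

theorem eq_of_forall_prefix (hw : Path μ w ν) (hw' : Path μ w' ν)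
    (h : ∀ a t α, w = a ++ t → Path μ a α → ∃ a' r, w' = a' ++ r ∧ Path μ a' α) : w = w' := by
  induction w generalizing μ w' with
  | nil =>
    have h1 := hw.card
    have h2 := hw'.card
    simp only [List.length_nil] at h1
    exact (List.length_eq_zero_iff.1 (by omega)).symm
  | cons x w ih =>
    obtain ⟨κ, h1, h2⟩ := hw
    have hcons : ∀ {a α}, Path μ a α → α.card ≠ μ.card → ∃ y a', a = y :: a' := by
      intro a α h hc
      cases a with
      | nil => exact absurd (congrArg YoungDiagram.card (Path.nil_iff.1 h).symm) hc
      | cons y a' => exact ⟨y, a', rfl⟩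
    obtain ⟨a, r, rfl, ha⟩ := h [x] w κ rfl (Path.singleton_iff.2 h1)
    have hc := h1.card
    obtain ⟨y, a', rfl⟩ := hcons ha (by omega)
    have hl := ha.card
    simp only [List.length_cons] at hl
    obtain rfl := List.length_eq_zero_iff.1 (show a'.length = 0 by omega)
    obtain rfl := (Path.singleton_iff.1 ha).content_unique h1
    obtain ⟨κ', h1', h2'⟩ := hw'
    obtain rfl := h1'.unique h1
    rw [ih h2 h2' ?_]
    · rfl
    · intro b t α hb hbα
      obtain ⟨b', r', e, hb'⟩ := h (y :: b) t α (by rw [hb]; rfl) ⟨_, h1, hbα⟩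
      have hc' := hbα.card
      obtain ⟨z, b'', rfl⟩ := hcons hb' (by omega)
      simp only [List.cons_append, List.cons.injEq] at e
      obtain ⟨rfl, rfl⟩ := e
      obtain ⟨κ₂, h3, h4⟩ := hb'
      obtain rfl := h3.unique h1
      exact ⟨b'', r', rfl, h4⟩

/-- Promotion of standard tableaux of rectangular shape has order dividing the number of boxes:
splitting the word after any prefix, the shape of the prefix is complemented twice. -/
theorem promote_iterate_length (h : Path ⊥ w (rectangle m n)) :
    promote^[w.length] w = w := by
  refine (eq_of_forall_prefix h (h.promote_iterate _) ?_).symm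
  rintro a t α rfl ha
  obtain ⟨r, hr⟩ := exists_promote_iterate h
  obtain ⟨α', ha', ht⟩ := Path.append_iff.1 h
  obtain rfl := ha'.unique ha
  have h1 := h.promote_iterate a.length
  rw [hr] at h1
  have h2 := ha.switch_rectangle ht
  obtain ⟨κ, h3, h4⟩ := Path.append_iff.1 h1
  obtain rfl := h3.unique h2
  obtain ⟨r', hr'⟩ := exists_promote_iterate h1
  refine ⟨(switch (switch a t).1 r).1, r', ?_, ?_⟩
  · rw [List.length_append, Nat.add_comm, Function.iterate_add_apply, hr]
    rw [length_switch_fst] at hr'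
    exact hr'
  · have h5 := h3.switch_rectangle h4
    rwa [complement_complement ht.le] at h5

/-- Moving the first of three layers to the end, three times in a row, is the identity. A rotation
of the layers agrees with iterated promotion up to dual equivalence of the layers. -/
theorem switch_three_rotations {β γ : YoungDiagram} (ha : Path ⊥ a β) (hb : Path β b γ)
    (hc : Path γ c (rectangle m n))
    {a₁ b₁ c₁ a₂ b₂ c₂ a₃ b₃ c₃ a₄ b₄ c₄ : List ℤ}
    (e₁ : switch a b = (b₁, a₁)) (e₂ : switch a₁ c = (c₁, a₂))
    (e₃ : switch b₁ c₁ = (c₂, b₂)) (e₄ : switch b₂ a₂ = (a₃, b₃))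
    (e₅ : switch c₂ a₃ = (a₄, c₃)) (e₆ : switch c₃ b₃ = (b₄, c₄)) :
    a₄ = a ∧ b₄ = b ∧ c₄ = c := by
  obtain ⟨ra, hra⟩ := exists_rectifies ha
  obtain ⟨rb, hrb⟩ := exists_rectifies hb
  obtain ⟨rc, hrc⟩ := exists_rectifies hc
  -- the rectifications of the three layers never change
  obtain ⟨κ₁, pb₁, pa₁, hrb₁, hra₁⟩ := hra.switch ha hb hrb
  rw [e₁] at pb₁ pa₁ hrb₁ hra₁
  obtain ⟨κ₂, pc₁, pa₂, hrc₁, hra₂⟩ := hra₁.switch pa₁ hc hrc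
  rw [e₂] at pc₁ pa₂ hrc₁ hra₂
  obtain ⟨κ₃, pc₂, pb₂, hrc₂, hrb₂⟩ := hrb₁.switch pb₁ pc₁ hrc₁
  rw [e₃] at pc₂ pb₂ hrc₂ hrb₂
  obtain ⟨κ₄, pa₃, pb₃, hra₃, hrb₃⟩ := hrb₂.switch pb₂ pa₂ hra₂
  rw [e₄] at pa₃ pb₃ hra₃ hrb₃
  obtain ⟨κ₅, pa₄, pc₃, hra₄, hrc₃⟩ := hrc₂.switch pc₂ pa₃ hra₃
  rw [e₅] at pa₄ pc₃ hra₄ hrc₃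
  obtain ⟨κ₆, pb₄, pc₄, hrb₄, hrc₄⟩ := hrc₃.switch pc₃ pb₃ hrb₃
  rw [e₆] at pb₄ pc₄ hrb₄ hrc₄
  simp only at *
  -- promoting past `a`
  have hw₀ := ha.append (hb.append hc)
  obtain ⟨r₁, hr₁⟩ := exists_promote_iterate hw₀
  have hw₁ := hw₀.promote_iterate a.length
  rw [hr₁, switch_append_right, e₁] at hw₁
  rw [switch_append_right, e₁] at hr₁
  simp only [e₂, List.append_assoc] at hw₁ hr₁
  obtain ⟨κ, q1, κ', q2, pr₁⟩ : ∃ κ, Path ⊥ b₁ κ ∧ ∃ κ', Path κ c₁ κ' ∧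
      Path κ' r₁ (rectangle m n) := by
    obtain ⟨κ, q1, q⟩ := Path.append_iff.1 hw₁
    exact ⟨κ, q1, Path.append_iff.1 q⟩
  obtain rfl := q1.unique pb₁
  obtain rfl := q2.unique pc₁
  have k₁ := KnuthEquiv.of_path_rectangle pr₁ pa₂
  -- promoting past `b₁`
  obtain ⟨r₂, hr₂⟩ := exists_promote_iterate hw₁
  have hw₂ := hw₁.promote_iterate b₁.length
  rw [hr₂, switch_append_right, e₃] at hw₂
  rw [switch_append_right, e₃] at hr₂
  simp only [List.append_assoc] at hw₂ hr₂
  obtain ⟨-, k₂⟩ := k₁.switch_right (pb₂.append pr₁)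
  rw [e₄] at k₂
  obtain ⟨κ, q3, κ', q4, pr₂⟩ : ∃ κ, Path ⊥ c₂ κ ∧ ∃ κ', Path κ (switch b₂ r₁).1 κ' ∧
      Path κ' r₂ (rectangle m n) := by
    obtain ⟨κ, q3, q⟩ := Path.append_iff.1 hw₂
    exact ⟨κ, q3, Path.append_iff.1 q⟩
  obtain rfl := q3.unique pc₂
  obtain rfl := (k₂.path q4).unique pa₃
  have k₃ := KnuthEquiv.of_path_rectangle pr₂ pb₃
  -- promoting past `c₂`
  obtain ⟨r₃, hr₃⟩ := exists_promote_iterate hw₂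
  have hw₃ := hw₂.promote_iterate c₂.length
  rw [hr₃, switch_append_right] at hw₃
  rw [switch_append_right] at hr₃
  obtain ⟨e₇, k₄⟩ := k₂.switch_right (pc₂.append q4)
  rw [e₅] at e₇ k₄
  simp only at e₇ k₄ k₂
  rw [e₇] at hr₃ hw₃
  obtain ⟨-, k₅⟩ := k₃.switch_right (pc₃.append pr₂)
  rw [e₆] at k₅
  simp only [List.append_assoc] at hr₃ hw₃ k₅
  -- altogether every box has been promoted once
  have hlen : (a ++ (b ++ c)).length = c₂.length + (b₁.length + a.length) := by
    have l1 := congrArg (List.length ∘ Prod.fst) e₁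
    have l2 := congrArg (List.length ∘ Prod.fst) e₂
    have l3 := congrArg (List.length ∘ Prod.fst) e₃
    simp only [Function.comp_apply, length_switch_fst] at l1 l2 l3
    simp only [List.length_append]
    omega
  have hfull := promote_iterate_length hw₀
  rw [hlen, Function.iterate_add_apply, Function.iterate_add_apply, hr₁, hr₂, hr₃] at hfull
  have la : (switch c₂ (switch b₂ r₁).1).1.length = a.length := by
    have c1 := pr₁.card
    have c2 := (ha.append (hb.append hc)).card
    have c3 := hw₁.card
    have l1 := congrArg (List.length ∘ Prod.fst) e₁
    have l2 := congrArg (List.length ∘ Prod.fst) e₂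
    simp only [Function.comp_apply, length_switch_fst] at l1 l2 ⊢
    simp only [List.length_append] at c2 c3
    omega
  have lb : (switch c₃ r₂).1.length = b.length := by
    have c2 := hw₁.card
    have c3 := hw₂.card
    have l1 := congrArg (List.length ∘ Prod.fst) e₁
    have l3 := congrArg (List.length ∘ Prod.fst) e₃
    simp only [Function.comp_apply, length_switch_fst] at l1 l3 ⊢
    simp only [List.length_append, length_switch_fst] at c2 c3
    omega
  -- the layers are dual equivalent to the original ones and have the same rectifications
  obtain ⟨f1, f2⟩ := List.append_inj hfull la
  obtain ⟨f3, f4⟩ := List.append_inj f2 lb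
  rw [f1] at k₄
  rw [f3] at k₅
  obtain rfl := pa₄.unique (k₄.path ha)
  have g1 := hra.eq_of_knuthEquiv ha k₄ hra₄
  obtain rfl := pb₄.unique (k₅.path hb)
  have g2 := hrb.eq_of_knuthEquiv hb k₅ hrb₄
  have g3 := hrc.eq_of_knuthEquiv hc (KnuthEquiv.of_path_rectangle hc pc₄) hrc₄
  exact ⟨g1.symm, g2.symm, g3.symm⟩

end Promotion

/-! ### Growth diagrams in terms of content words -/

section Growth

variable {μ ν α β γ : YoungDiagram} {x : ℤ} {u t c : ℕ → YoungDiagram} {p q k : ℕ}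

/-- The sum of the contents of the boxes of a shape. -/
def contentSum (μ : YoungDiagram) : ℤ := ∑ d ∈ μ.cells, ((d.2 : ℤ) - d.1)

/-- The content of the box by which `ν` exceeds `μ`, when there is just one. -/
def edgeContent (μ ν : YoungDiagram) : ℤ := contentSum ν - contentSum μ

theorem AddBox.edgeContent_eq (h : AddBox μ x ν) : edgeContent μ ν = x := by
  obtain ⟨i, j, hx, h0, h1⟩ := h
  unfold edgeContent contentSum
  rw [AddBox.cells_eq h1, Finset.sum_insert (by simpa using h0)]
  simp only
  omega

theorem OneBox.addBox (h : OneBox μ ν) : AddBox μ (edgeContent μ ν) ν := by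
  obtain ⟨x, hx⟩ := h.exists_addBox
  rwa [hx.edgeContent_eq]

/-- The local rule for shapes is `localSwap` on contents. -/
theorem localSwap_edgeContent (h1 : OneBox γ α) (h2 : OneBox α β) :
    localSwap (edgeContent γ α) (edgeContent α β) =
      (edgeContent γ (corner γ α β), edgeContent (corner γ α β) β) := by
  obtain ⟨h3, h4⟩ := corner_oneBox h1 h2
  have hsum : edgeContent γ (corner γ α β) + edgeContent (corner γ α β) β =
      edgeContent γ α + edgeContent α β := by
    unfold edgeContent; ring
  have hor := h1.addBox.eq_or_content_eq h2.addBox h3.addBox h4.1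
  unfold localSwap
  split_ifs with hadj
  · rcases hor with e | e
    · rw [e]
    · have h5 := h3.addBox
      rw [e] at h5
      rcases hadj with hadj | hadj
      · exact absurd hadj (h5.not_adjacent h1.addBox)
      · exact absurd hadj (h1.addBox.not_adjacent h5)
  · rcases hor with e | e
    · exfalso
      obtain ⟨δ, h5, h6⟩ := h1.addBox.swap h2.addBox (by omega) (by omega)
      have hne : δ ≠ α := by
        rintro rfl
        have hp : Path γ [edgeContent γ δ, edgeContent δ β] β :=
          ⟨δ, h1.addBox, Path.singleton_iff.2 h2.addBox⟩
        exact hp.ne (h1.addBox.content_unique h5)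
      have hlt : ∀ {μ ν : YoungDiagram} {x : ℤ}, AddBox μ x ν → μ < ν := by
        intro μ ν x h
        refine lt_of_le_of_ne h.le ?_
        rintro rfl
        have := h.card
        omega
      have hex : ∃ δ : YoungDiagram, γ < δ ∧ δ < β ∧ δ ≠ α := ⟨δ, hlt h5, hlt h6, hne⟩
      rw [corner, dif_pos hex] at e
      exact hex.choose_spec.2.2 e
    · ext <;> simp only <;> omega

/-- The content word of the first `k` steps of a chain of shapes. -/
def chainWord (c : ℕ → YoungDiagram) (k : ℕ) : List ℤ :=
  (List.range k).map fun i => edgeContent (c i) (c (i + 1))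

theorem chainWord_succ (c : ℕ → YoungDiagram) (k : ℕ) :
    chainWord c (k + 1) = chainWord c k ++ [edgeContent (c k) (c (k + 1))] := by
  simp [chainWord, List.range_succ]

theorem chainWord_succ' (c : ℕ → YoungDiagram) (k : ℕ) :
    chainWord c (k + 1) = edgeContent (c 0) (c 1) :: chainWord (fun i => c (i + 1)) k := by
  simp [chainWord, List.range_succ_eq_map, Function.comp_def]

theorem chainWord_congr {c c' : ℕ → YoungDiagram} (h : ∀ i ≤ k, c i = c' i) :
    chainWord c k = chainWord c' k := by
  refine List.map_congr_left fun i hi => ?_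
  rw [List.mem_range] at hi
  rw [h i (by omega), h (i + 1) (by omega)]

theorem path_chainWord (h : ∀ i < k, OneBox (c i) (c (i + 1))) :
    Path (c 0) (chainWord c k) (c k) := by
  induction k with
  | zero => rfl
  | succ k ih =>
    rw [chainWord_succ]
    exact (ih fun i hi => h i (by omega)).append (Path.singleton_iff.2 (h k (by omega)).addBox)

/-- Passing a letter through a word computes one row of the growth diagram from the row above. -/
theorem pass_chainWord {s s' : ℕ → YoungDiagram} (hs : ∀ j < q, OneBox (s j) (s (j + 1)))
    (hv : ∀ j ≤ q, OneBox (s' j) (s j))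
    (hc : ∀ j < q, s' (j + 1) = corner (s' j) (s j) (s (j + 1))) :
    pass (edgeContent (s' 0) (s 0)) (chainWord s q) =
      (chainWord s' q, edgeContent (s' q) (s q)) := by
  induction q with
  | zero => rfl
  | succ q ih =>
    rw [chainWord_succ, chainWord_succ, pass_append, ih (fun j hj => hs j (by omega))
      (fun j hj => hv j (by omega)) (fun j hj => hc j (by omega))]
    simp only [pass, localSwap_edgeContent (hv q (by omega)) (hs q (by omega)),
      ← hc q (by omega)]

/-- The row `k` steps below the top one and the part of the right column above it are computed from
the top row and the left column by switching. -/
theorem switch_growth (hu : ∀ i < p, OneBox (u i) (u (i + 1)))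
    (ht : ∀ j < q, OneBox (t j) (t (j + 1))) (hut : u p = t 0) (k : ℕ) (hk : k ≤ p) :
    switch (chainWord (fun i => growth u p t (k - i) 0) k) (chainWord t q) =
      (chainWord (growth u p t k) q, chainWord (fun i => growth u p t (k - i) q) k) := by
  induction k with
  | zero =>
    have : growth u p t 0 = t := funext fun j => by rw [growth]
    rw [this]
    rfl
  | succ k ih =>
    rw [chainWord_succ', chainWord_succ']
    simp only [Nat.add_sub_add_right, switch, ih (by omega), Nat.sub_zero, Nat.add_sub_cancel]
    obtain ⟨h1, h2⟩ := growth_edges hu ht hut k (by omega)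
    rw [pass_chainWord h1 (h2 (by omega)) (fun j hj => by rw [growth])]

end Growth

namespace SYT

variable {lam mu nu lam' nu' : YoungDiagram}

/-- The content word of a standard tableau. -/
def word (T : SYT lam nu) : List ℤ := chainWord T.chain T.size

theorem path_word (T : SYT lam nu) : Path lam T.word nu := by
  have h := path_chainWord fun i hi => T.chain_oneBox (i := i) hi
  rwa [T.chain_zero, T.chain_size] at h

theorem mem_chain (T : SYT lam nu) {d : ℕ × ℕ} (hd : d ∈ nu.cells \ lam.cells) {i : ℕ} :
    d ∈ T.chain i ↔ T.entry d ≤ i := by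
  rw [← YoungDiagram.mem_cells]
  have := (Finset.mem_sdiff.1 hd).2
  simp only [chain, Finset.mem_union, Finset.mem_filter, hd, this, false_or, true_and]

theorem word_injective : Function.Injective (word : SYT lam nu → List ℤ) := by
  intro T T' h
  have hchain : ∀ i ≤ T.size, T.chain i = T'.chain i := by
    intro i
    induction i with
    | zero => intro _; rw [T.chain_zero, T'.chain_zero]
    | succ i ih =>
      intro hi
      have h1 := (T.chain_oneBox (i := i) hi).addBox
      have h2 := (T'.chain_oneBox (i := i) hi).addBox
      have h3 : edgeContent (T.chain i) (T.chain (i + 1)) =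
          edgeContent (T'.chain i) (T'.chain (i + 1)) :=
        List.map_inj_left.1 h i (List.mem_range.2 hi)
      rw [← ih (by omega)] at h2 h3
      rw [h3] at h1
      exact h1.unique h2
  ext d
  by_cases hd : d ∈ nu.cells \ lam.cells
  · have key : ∀ i ≤ T.size, T.entry d ≤ i ↔ T'.entry d ≤ i := fun i hi => by
      rw [← T.mem_chain hd, ← T'.mem_chain hd, hchain i hi]
    have h1 := (T.bijOn.mapsTo (Finset.mem_coe.2 hd)).2
    have h2 := (T'.bijOn.mapsTo (Finset.mem_coe.2 hd)).2
    exact le_antisymm ((key _ h2).2 le_rfl) ((key _ h1).1 le_rfl)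
  · rw [T.outside d hd, T'.outside d hd]

theorem word_ofChain {c : ℕ → YoungDiagram} {k : ℕ} (hc : ∀ i < k, OneBox (c i) (c (i + 1)))
    (h0 : c 0 = lam) (hk : c k = nu) : (ofChain c k hc h0 hk).word = chainWord c k := by
  subst h0 hk
  have hle : c 0 ≤ c k := chain_le hc (Nat.zero_le k) le_rfl
  have hsize : (ofChain c k hc rfl rfl).size = k := by
    have h1 := chain_card hc le_rfl
    have h2 := Finset.card_sdiff_of_subset (s := (c 0).cells) (t := (c k).cells) hle
    simp only [YoungDiagram.card] at h1
    simp only [size]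
    omega
  rw [word, hsize]
  refine chainWord_congr fun i hi => SetLike.ext fun d => ?_
  by_cases hd : d ∈ (c k).cells \ (c 0).cells
  · rw [mem_chain _ hd]
    exact chainEntry_le_iff hc hd hi
  · rw [← YoungDiagram.mem_cells, chain]
    simp only [Finset.mem_union, Finset.mem_filter, hd, false_and, or_false]
    simp only [Finset.mem_sdiff, not_and, not_not] at hd
    exact ⟨fun h => chain_le hc (Nat.zero_le i) hi h, fun h => hd (chain_le hc hi le_rfl h)⟩

theorem word_infusion1 (U : SYT lam mu) (T : SYT mu nu) :
    (infusion1 U T).word = chainWord (growthOf U T U.size) T.size :=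
  word_ofChain _ _ _

theorem word_infusion2 (U : SYT lam mu) (T : SYT mu nu) :
    (infusion2 U T).word = chainWord (fun i => growthOf U T (U.size - i) T.size) U.size :=
  word_ofChain _ _ _

theorem switch_word (U : SYT lam mu) (T : SYT mu nu) :
    switch U.word T.word = ((infusion1 U T).word, (infusion2 U T).word) := by
  have hut : U.chain U.size = T.chain 0 := by rw [U.chain_size, T.chain_zero]
  have h := switch_growth (fun _ => U.chain_oneBox) (fun _ => T.chain_oneBox) hut U.size le_rfl
  rw [word_infusion1, word_infusion2]
  refine Eq.trans ?_ h
  refine congrArg (fun w => switch w T.word) (chainWord_congr fun i hi => ?_)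
  rw [growth_left hut, Nat.sub_sub_self hi]

end SYT

/-! ### The two operators on layered tableaux -/

namespace LayeredTableau

variable {Lam : YoungDiagram}

theorem ext_word {X Y : LayeredTableau Lam} (hA : X.A.word = Y.A.word)
    (hB : X.B.word = Y.B.word) (hC : X.C.word = Y.C.word) : X = Y := by
  obtain ⟨α, γ, A, B, C⟩ := X
  obtain ⟨α', γ', A', B', C'⟩ := Y
  simp only at hA hB hC
  obtain rfl : α = α' := A.path_word.unique (hA ▸ A'.path_word)
  obtain rfl : γ = γ' := B.path_word.unique (hB ▸ B'.path_word)
  rw [SYT.word_injective hA, SYT.word_injective hB, SYT.word_injective hC]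

theorem switch_I1 (X : LayeredTableau Lam) :
    switch X.A.word X.B.word = (X.I1.A.word, X.I1.B.word) := SYT.switch_word _ _

theorem switch_I2 (X : LayeredTableau Lam) :
    switch X.B.word X.C.word = (X.I2.B.word, X.I2.C.word) := SYT.switch_word _ _

theorem I1_I1 (X : LayeredTableau Lam) : X.I1.I1 = X := by
  have h := switch_switch X.A.word X.B.word
  rw [X.switch_I1, X.I1.switch_I1, Prod.mk.injEq] at h
  exact ext_word h.1 h.2 rfl

theorem I2_I2 (X : LayeredTableau Lam) : X.I2.I2 = X := by
  have h := switch_switch X.B.word X.C.word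
  rw [X.switch_I2, X.I2.switch_I2, Prod.mk.injEq] at h
  exact ext_word rfl h.1 h.2

/-- Applying `I1` and then `I2` rotates the three layers; the third power is the identity. -/
theorem rotate_three {m n : ℕ} (X : LayeredTableau (rectangle m n)) :
    X.I1.I2.I1.I2.I1.I2 = X := by
  obtain ⟨h1, h2, h3⟩ := switch_three_rotations X.A.path_word X.B.path_word X.C.path_word
    X.switch_I1 X.I1.switch_I2 X.I1.I2.switch_I1 X.I1.I2.I1.switch_I2
    X.I1.I2.I1.I2.switch_I1 X.I1.I2.I1.I2.I1.switch_I2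
  exact ext_word h1 h2 h3

theorem braid {m n : ℕ} (X : LayeredTableau (rectangle m n)) : X.I1.I2.I1 = X.I2.I1.I2 := by
  have h := congrArg (fun Y => Y.I2.I1.I2) X.rotate_three
  simpa only [I1_I1, I2_I2] using h

end LayeredTableau

/-! ### The symmetric group on three letters -/

/-- Two involutions satisfying the braid relation define a homomorphism from `S₃`, given by its
values on the six elements. -/
theorem exists_hom_perm_three {G : Type*} [Group G] (s t : G) (hs : s * s = 1) (ht : t * t = 1)
    (hst : s * t * s = t * s * t) :
    ∃ φ : Equiv.Perm (Fin 3) →* G, φ (Equiv.swap 0 1) = s ∧ φ (Equiv.swap 1 2) = t := by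
  classical
  let a : Equiv.Perm (Fin 3) := Equiv.swap 0 1
  let b : Equiv.Perm (Fin 3) := Equiv.swap 1 2
  let f : Equiv.Perm (Fin 3) → G := fun σ =>
    if σ = 1 then 1 else if σ = a then s else if σ = b then t else
      if σ = a * b then s * t else if σ = b * a then t * s else s * t * s
  have hall : ∀ σ : Equiv.Perm (Fin 3),
      σ = 1 ∨ σ = a ∨ σ = b ∨ σ = a * b ∨ σ = b * a ∨ σ = a * b * a := by decide
  have f1 : f 1 = 1 := if_pos rfl
  have fa : f a = s := by
    simp only [f, if_neg (show a ≠ 1 by decide), if_true]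
  have fb : f b = t := by
    simp only [f, if_neg (show b ≠ 1 by decide), if_neg (show b ≠ a by decide), if_true]
  have fab : f (a * b) = s * t := by
    simp only [f, if_neg (show a * b ≠ 1 by decide), if_neg (show a * b ≠ a by decide),
      if_neg (show a * b ≠ b by decide), if_true]
  have fba : f (b * a) = t * s := by
    simp only [f, if_neg (show b * a ≠ 1 by decide), if_neg (show b * a ≠ a by decide),
      if_neg (show b * a ≠ b by decide), if_neg (show b * a ≠ a * b by decide), if_true]
  have faba : f (a * b * a) = s * t * s := by
    simp only [f, if_neg (show a * b * a ≠ 1 by decide), if_neg (show a * b * a ≠ a by decide),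
      if_neg (show a * b * a ≠ b by decide), if_neg (show a * b * a ≠ a * b by decide),
      if_neg (show a * b * a ≠ b * a by decide)]
  have haa : a * a = 1 := by decide
  have hbb : b * b = 1 := by decide
  have hab : a * b * a = b * a * b := by decide
  have ha : ∀ σ, f (a * σ) = s * f σ := by
    intro σ
    rcases hall σ with rfl | rfl | rfl | rfl | rfl | rfl
    · rw [mul_one, fa, f1, mul_one]
    · rw [haa, f1, fa, hs]
    · rw [fab, fb]
    · rw [← mul_assoc, haa, one_mul, fb, fab, ← mul_assoc, hs, one_mul]
    · rw [← mul_assoc, faba, fba, mul_assoc]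
    · rw [mul_assoc, ← mul_assoc a a, haa, one_mul, fba, ← mul_assoc a b a, faba, mul_assoc s t s,
        ← mul_assoc s s, hs, one_mul]
  have hb : ∀ σ, f (b * σ) = t * f σ := by
    intro σ
    rcases hall σ with rfl | rfl | rfl | rfl | rfl | rfl
    · rw [mul_one, fb, f1, mul_one]
    · rw [fba, fa]
    · rw [hbb, f1, fb, ht]
    · rw [← mul_assoc, ← hab, faba, fab, hst, mul_assoc]
    · rw [← mul_assoc, hbb, one_mul, fa, fba, ← mul_assoc, ht, one_mul]
    · rw [faba, hab, mul_assoc b a b, ← mul_assoc b b, hbb, one_mul, fab, hst, mul_assoc t s t,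
        ← mul_assoc t t, ht, one_mul]
  refine ⟨⟨⟨f, f1⟩, fun σ τ => ?_⟩, fa, fb⟩
  change f (σ * τ) = f σ * f τ
  rcases hall σ with rfl | rfl | rfl | rfl | rfl | rfl
  · rw [one_mul, f1, one_mul]
  · rw [ha, fa]
  · rw [hb, fb]
  · rw [mul_assoc, ha, hb, fab, mul_assoc]
  · rw [mul_assoc, hb, ha, fba, mul_assoc]
  · rw [mul_assoc, mul_assoc, ha, hb, ha, faba, mul_assoc, mul_assoc]

end LayeredTableaux

theorem mainTheorem2 (m n : ℕ) :
    let I₁ : LayeredTableaux.LayeredTableau (LayeredTableaux.rectangle m n) →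
        LayeredTableaux.LayeredTableau (LayeredTableaux.rectangle m n) :=
      LayeredTableaux.LayeredTableau.I1
    let I₂ : LayeredTableaux.LayeredTableau (LayeredTableaux.rectangle m n) →
        LayeredTableaux.LayeredTableau (LayeredTableaux.rectangle m n) :=
      LayeredTableaux.LayeredTableau.I2
    I₁ ∘ I₂ ∘ I₁ = I₂ ∘ I₁ ∘ I₂ ∧
    I₁ ∘ I₁ = id ∧
    I₂ ∘ I₂ = id ∧
    ∃ φ : Equiv.Perm (Fin 3) →*
        Equiv.Perm (LayeredTableaux.LayeredTableau (LayeredTableaux.rectangle m n)),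
      ⇑(φ (Equiv.swap 0 1)) = I₁ ∧ ⇑(φ (Equiv.swap 1 2)) = I₂ := by
  intro I₁ I₂
  have h1 : Function.Involutive I₁ := LayeredTableaux.LayeredTableau.I1_I1
  have h2 : Function.Involutive I₂ := LayeredTableaux.LayeredTableau.I2_I2
  have h3 : ∀ X, I₁ (I₂ (I₁ X)) = I₂ (I₁ (I₂ X)) := LayeredTableaux.LayeredTableau.braid
  refine ⟨funext h3, funext h1, funext h2, ?_⟩
  obtain ⟨φ, e1, e2⟩ := LayeredTableaux.exists_hom_perm_three (h1.toPerm I₁) (h2.toPerm I₂)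
    (Equiv.ext h1) (Equiv.ext h2) (Equiv.ext h3)
  exact ⟨φ, by rw [e1]; rfl, by rw [e2]; rfl⟩
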